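/- Let $\mathcal H$ be a real separable Hilbert space with its Borel $\sigma$-algebra, let $(\Omega,\mathcal F,\mathbb P)$ be a probability space, and let $f:\mathcal H\to\mathbb R$ be convex and differentiable with $\nabla f$ $L$-Lipschitz continuous ($L>0$) and $S=\operatorname{argmin} f\neq\emptyset$. Let $(s_k)_{k\ge 0}$ be a non-increasing sequence in $]0,1/L]$, let $\alpha>0$ and $r\in\,]0,1[$, and put $\alpha_k=1-\frac{\alpha}{k^r}$ for $k\ge1$. Let $(e_k)_{k\ge0}$ be integrable $\mathcal H$-valued random variables, let $y_0$ be a square-integrable $\mathcal H$-valued random variable, put $w_{-1}=y_0$, and let $(y_k)$ be generated by the stochastic Ravine accelerated gradient method (SRAG): for all $k\ge 0$, $$w_k=y_k-s_k\big(\nabla f(y_k)+e_k\big),\qquad y_{k+1}=w_k+\alpha_{k+1}(w_k-w_{k-1}).$$ Let $\mathcal F_k=\sigma\big(y_0,(w_i)_{0\le i\le k-1}\big)$ and let $\sigma_k\ge0$ be given by $\sigma_k^2=\mathbb E\big[\|e_k\|^2\,\big|\,\mathcal F_k\big]$. Assume that, almost surely, for all $k\ge0$, $\mathbb E[e_k\mid\mathcal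 F_k]=0$ and $\sigma_k<\infty$, and that $$\sum_{k\in\mathbb N}k^r s_k\sigma_k<+\infty\quad\text{almost surely}.$$ Then the following hold almost surely: (i) $f(y_k)-\min_{\mathcal H} f=o\!\left(\frac1{s_kk^{2r}}\right)$ and $\|y_k-y_{k-1}\|=o\!\left(\frac1{k^r}\right)$ as $k\to+\infty$; (ii) $\displaystyle\sum_{k\in\mathbb N}k^rs_k\big(f(y_k)-\min_{\mathcal H} f\big)<+\infty$ and $\displaystyle\sum_{k\ge1}k^r\|y_k-y_{k-1}\|^2<+\infty$; (iii) if moreover $\inf_k s_k>0$, then $\displaystyle\sum_{k\in\mathbb N}k^{2r}\|\nabla f(y_k)\|^2<+\infty$, and $(y_k)$ converges weakly, almost surely, to a random variable with values in $\operatorname{argmin} f$. -/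

import Mathlib

open MeasureTheory Filter Topology Asymptotics
open scoped ENNReal NNReal Gradient

section SRAG

variable {Ω H : Type*} [NormedAddCommGroup H] [InnerProductSpace ℝ H]

/-- The processes `y = (y_k)_{k ≥ 0}` and `w = (w_k)_{k ≥ 0}` are generated by the stochastic Ravine
accelerated gradient method with step sizes `s_k`, extrapolation coefficients `a_k` and gradient
errors `e_k`: for all `k ≥ 0`,
`w_k = y_k - s_k (∇f(y_k) + e_k)` and `y_{k+1} = w_k + a_{k+1} (w_k - w_{k-1})`,
with the convention `w_{-1} = y_0`. -/
structure IsSRAG [CompleteSpace H] (f : H → ℝ) (s a : ℕ → ℝ) (e y w : ℕ → Ω → H) : Prop where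
  w_eq : ∀ k ω, w k ω = y k ω - s k • (∇ f (y k ω) + e k ω)
  y_one : ∀ ω, y 1 ω = w 0 ω + a 1 • (w 0 ω - y 0 ω)
  y_add_two : ∀ k ω, y (k + 2) ω = w (k + 1) ω + a (k + 2) • (w (k + 1) ω - w k ω)

/-- The `σ`-algebras `ℱ_k = σ(y_0, (w_i)_{i ≤ k-1})` of the canonical filtration. -/
abbrev sragSigma [MeasurableSpace H] (y w : ℕ → Ω → H) (k : ℕ) : MeasurableSpace Ω :=
  MeasurableSpace.comap (y 0) inferInstance ⊔
    ⨆ i ∈ Set.Iio k, MeasurableSpace.comap (w i) inferInstance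

/-- The conditional second moment `σ_k² = 𝔼[‖e_k‖² | ℱ_k]`, as the conditional expectation of a
nonnegative random variable (no integrability needed), with values in `[0, ∞]`. -/
noncomputable def noiseVar [MeasurableSpace Ω] (P : Measure Ω) (ℱ : ℕ → MeasurableSpace Ω)
    (e : ℕ → Ω → H) (k : ℕ) : Ω → ℝ≥0∞ :=
  condLExp (ℱ k) P (fun ω => ‖e k ω‖ₑ ^ 2)

/-- The conditional standard deviation `σ_k` as a real number (meaningful where `σ_k² < ∞`). -/
noncomputable def noiseStd [MeasurableSpace Ω] (P : Measure Ω) (ℱ : ℕ → MeasurableSpace Ω)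
    (e : ℕ → Ω → H) (k : ℕ) (ω : Ω) : ℝ :=
  √ (noiseVar P ℱ e k ω).toReal

/-- Membership in `ℓ^p_+(ℱ)`: sequences of `[0, ∞)`-valued random variables `a_k`, each
`ℱ_k`-measurable, with `∑ a_k^p < ∞` almost surely. -/
structure MemEllPlus [MeasurableSpace Ω] (P : Measure Ω) (ℱ : ℕ → MeasurableSpace Ω) (p : ℝ)
    (a : ℕ → Ω → ℝ) : Prop where
  measurable : ∀ k, Measurable[ℱ k] (a k)
  nonneg : ∀ k ω, 0 ≤ a k ω
  summable : ∀ᵐ ω ∂P, Summable fun k => a k ω ^ p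

end SRAG

/-! ### Inequalities for convex functions with Lipschitz gradient, and one inertial step. -/

section SmoothConvex

variable {H : Type*} [NormedAddCommGroup H] [InnerProductSpace ℝ H] [CompleteSpace H]
  {f : H → ℝ} {L : ℝ≥0}

/-! With x_0 = y_0 and x_{n+1} = w_n (`sragIter`), the Ravine recursion becomes Nesterov's scheme:
y_{n+1} extrapolates from x_n and x_{n+1}, and x_{n+2} is a noisy gradient step from y_{n+1}. The
natural weights are p_n = n^r, for which p_n α_n = p_n - α.

Fix a minimiser z and l = α/2. The energy E_l(n) = s_n p_n² (f(x_{n+1}) - f(z)) + ½‖l(x_n - z) +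
p_n(x_{n+1} - x_n)‖² + ½ l²‖x_n - z‖² satisfies, for large n, E_l(n+1) + D_n ≤ (1 + a_n) E_l(n) +
⟨ζ_n, e_{n+1}⟩ + q_n‖e_{n+1}‖² (`inertialEnergy_add_decrease_le`). Here D_n ≥ 0, ζ_n depends only on
the past, and a_n is a multiple of (p_{n+1} - p_n)²/p_n = O(n^{r-2}), summable because r < 1. Since
q_n = 2 p_{n+1}² s_{n+1}², the noise hypothesis makes the conditional means of the last term
summable. A Robbins–Siegmund theorem (`robbins_siegmund_noisy`), localised so that no energy has to
be integrable, gives convergence of E_l(n) and ∑ D_n < ∞. The sums in the theorem are read off from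
D_n, then transferred from x_n to y_n.

For the little-o rates take l = 0. The energy E_0(n) grows by at most 4 p_n s_n (f(x_{n+1}) - f(z))
plus noise, which is summable by the first stage, so E_0(n) converges. Moreover ∑ E_0(n)/n^r < ∞
while ∑ n^{-r} = ∞, so the limit is 0.

For weak convergence, subtracting the vanishing terms from E_l(n) shows that ‖x_n - z‖ converges,
and Opial's lemma (`exists_weak_limit_isMinOn`) applies. The null set depends on z; separability
reduces to countably many minimisers. -/

theorem hasDerivAt_comp_line (hdiff : Differentiable ℝ f) (x v : H) (t : ℝ) :
    HasDerivAt (fun t : ℝ => f (x + t • v)) (inner ℝ (∇ f (x + t • v)) v) t := by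
  have h1 : HasDerivAt (fun t : ℝ => x + t • v) v t := by
    simpa using ((hasDerivAt_id t).smul_const v).const_add x
  have h2 := ((hdiff (x + t • v)).hasGradientAt).hasFDerivAt
  have h3 := h2.comp_hasDerivAt t h1
  simp only [InnerProductSpace.toDual_apply_apply] at h3
  exact h3

/-- A differentiable convex function lies above its tangents. -/
theorem ConvexOn.add_inner_gradient_le (hconv : ConvexOn ℝ Set.univ f) (hdiff : Differentiable ℝ f)
    (x y : H) : f x + inner ℝ (∇ f x) (y - x) ≤ f y := by
  have hc : ConvexOn ℝ Set.univ (fun t : ℝ => f (x + t • (y - x))) := by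
    have := hconv.comp_affineMap (AffineMap.lineMap (k := ℝ) x y)
    simpa [Function.comp_def, AffineMap.lineMap_apply, add_comm] using this
  have h0 := hasDerivAt_comp_line hdiff x (y - x) 0
  have := hc.le_slope_of_hasDerivAt (Set.mem_univ 0) (Set.mem_univ 1) one_pos h0
  simp only [slope_def_field, zero_smul, add_zero, one_smul, sub_zero, div_one,
    add_sub_cancel] at this
  linarith

/-- The descent lemma for functions with Lipschitz gradient. -/
theorem LipschitzWith.le_add_inner_gradient (hdiff : Differentiable ℝ f)
    (hlip : LipschitzWith L (∇ f)) (x y : H) :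
    f y ≤ f x + inner ℝ (∇ f x) (y - x) + L / 2 * ‖y - x‖ ^ 2 := by
  set v := y - x with hv
  let φ : ℝ → ℝ := fun t => f (x + t • v) - t * inner ℝ (∇ f x) v - L / 2 * ‖v‖ ^ 2 * t ^ 2
  have hφ : ∀ t, HasDerivAt φ
      (inner ℝ (∇ f (x + t • v)) v - inner ℝ (∇ f x) v - L / 2 * ‖v‖ ^ 2 * (2 * t)) t := by
    intro t
    have h1 := (hasDerivAt_comp_line hdiff x v t).sub
      ((hasDerivAt_id t).mul_const (inner ℝ (∇ f x) v))
    have h2 := h1.sub ((hasDerivAt_pow 2 t).const_mul (L / 2 * ‖v‖ ^ 2))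
    refine HasDerivAt.congr_deriv h2 ?_
    norm_num
  have hanti : AntitoneOn φ (Set.Icc 0 1) := by
    refine antitoneOn_of_deriv_nonpos (convex_Icc 0 1)
      (fun t _ => (hφ t).continuousAt.continuousWithinAt)
      (fun t _ => (hφ t).differentiableAt.differentiableWithinAt) (fun t ht => ?_)
    rw [interior_Icc] at ht
    rw [(hφ t).deriv, ← inner_sub_left]
    have h1 := real_inner_le_norm (∇ f (x + t • v) - ∇ f x) v
    have h2 := hlip.dist_le_mul (x + t • v) x
    rw [dist_eq_norm, dist_eq_norm, add_sub_cancel_left, norm_smul, Real.norm_eq_abs,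
      abs_of_pos ht.1] at h2
    nlinarith [mul_le_mul_of_nonneg_right h2 (norm_nonneg v)]
  have := hanti (Set.left_mem_Icc.2 zero_le_one) (Set.right_mem_Icc.2 zero_le_one) zero_le_one
  simp only [φ, one_smul, zero_smul, add_zero] at this
  have hy : x + v = y := by rw [hv]; abel
  rw [hy] at this
  linarith

/-- Strengthened tangent inequality for convex functions with `L`-Lipschitz gradient. -/
theorem ConvexOn.add_inner_gradient_add_sq_le (hconv : ConvexOn ℝ Set.univ f)
    (hdiff : Differentiable ℝ f) (hL : 0 < L) (hlip : LipschitzWith L (∇ f)) (x y : H) :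
    f x + inner ℝ (∇ f x) (y - x) + 1 / (2 * L) * ‖∇ f y - ∇ f x‖ ^ 2 ≤ f y := by
  have hL' : (0 : ℝ) < L := hL
  set δ := ∇ f y - ∇ f x with hδ
  -- `δ` is the gradient at y of the tilted function f - ⟨∇f(x), ·⟩, which x minimises; the test
  -- point is its gradient step of length 1/L from y.
  have h1 := hconv.add_inner_gradient_le hdiff x (y - (1 / (L : ℝ)) • δ)
  have h2 := hlip.le_add_inner_gradient hdiff y (y - (1 / (L : ℝ)) • δ)
  have e1 : inner ℝ (∇ f x) (y - (1 / (L : ℝ)) • δ - x)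
      = inner ℝ (∇ f x) (y - x) - 1 / (L : ℝ) * inner ℝ (∇ f x) δ := by
    rw [sub_right_comm, inner_sub_right, inner_smul_right]
  have e2 : inner ℝ (∇ f y) (y - (1 / (L : ℝ)) • δ - y) = - (1 / (L : ℝ) * inner ℝ (∇ f y) δ) := by
    rw [sub_sub_cancel_left, inner_neg_right, inner_smul_right]
  have e3 : ‖y - (1 / (L : ℝ)) • δ - y‖ ^ 2 = (1 / (L : ℝ)) ^ 2 * ‖δ‖ ^ 2 := by
    rw [sub_sub_cancel_left, norm_neg, norm_smul, mul_pow, Real.norm_eq_abs, sq_abs]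
  have e4 : inner ℝ (∇ f y) δ - inner ℝ (∇ f x) δ = ‖δ‖ ^ 2 := by
    rw [← inner_sub_left, ← hδ, real_inner_self_eq_norm_sq]
  rw [e1] at h1
  rw [e2, e3] at h2
  have e5 : (L : ℝ) / 2 * ((1 / (L : ℝ)) ^ 2 * ‖δ‖ ^ 2) = 1 / (2 * L) * ‖δ‖ ^ 2 := by
    field_simp
  have e6 : 1 / (L : ℝ) * ‖δ‖ ^ 2 = 2 * (1 / (2 * L) * ‖δ‖ ^ 2) := by field_simp
  rw [e5] at h2
  have e7 : 1 / (L : ℝ) * inner ℝ (∇ f y) δ = 1 / (L : ℝ) * inner ℝ (∇ f x) δ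
      + 1 / (L : ℝ) * ‖δ‖ ^ 2 := by rw [← e4]; ring
  linarith

theorem IsMinOn.gradient_eq_zero {z : H} (hz : IsMinOn f Set.univ z) : ∇ f z = 0 := by
  have : fderiv ℝ f z = 0 := (hz.isLocalMin univ_mem).fderiv_eq_zero
  rw [gradient, this, map_zero]

theorem norm_gradient_sq_le (hconv : ConvexOn ℝ Set.univ f) (hdiff : Differentiable ℝ f)
    (hL : 0 < L) (hlip : LipschitzWith L (∇ f)) {z : H} (hz : IsMinOn f Set.univ z) (x : H) :
    1 / (2 * L) * ‖∇ f x‖ ^ 2 ≤ f x - f z := by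
  have := hconv.add_inner_gradient_add_sq_le hdiff hL hlip z x
  rw [hz.gradient_eq_zero, inner_zero_left, sub_zero] at this
  linarith

/-- Comparison of the optimality gaps at two points. -/
theorem sub_min_le_two_mul_add_sq (hconv : ConvexOn ℝ Set.univ f) (hdiff : Differentiable ℝ f)
    (hL : 0 < L) (hlip : LipschitzWith L (∇ f)) {z : H} (hz : IsMinOn f Set.univ z) (x y : H) :
    f y - f z ≤ 2 * (f x - f z) + L * ‖y - x‖ ^ 2 := by
  have hL' : (0 : ℝ) < L := hL
  have h1 := hlip.le_add_inner_gradient hdiff x y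
  have h2 := norm_gradient_sq_le hconv hdiff hL hlip hz x
  have h3 := real_inner_le_norm (∇ f x) (y - x)
  have h4 : ‖∇ f x‖ * ‖y - x‖ ≤ 1 / (2 * L) * ‖∇ f x‖ ^ 2 + L / 2 * ‖y - x‖ ^ 2 := by
    have : 0 ≤ 1 / (2 * (L : ℝ)) * (‖∇ f x‖ - L * ‖y - x‖) ^ 2 := by positivity
    have e : 1 / (2 * (L : ℝ)) * (‖∇ f x‖ - L * ‖y - x‖) ^ 2 = 1 / (2 * L) * ‖∇ f x‖ ^ 2
        + L / 2 * ‖y - x‖ ^ 2 - ‖∇ f x‖ * ‖y - x‖ := by field_simp; ring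
    linarith
  linarith

/-- One noisy gradient step of length `s ≤ 1 / L`. -/
theorem noisy_gradient_step_le (hconv : ConvexOn ℝ Set.univ f) (hdiff : Differentiable ℝ f)
    (hL : 0 < L) (hlip : LipschitzWith L (∇ f)) {s : ℝ} (hs : 0 < s) (hsL : s ≤ 1 / (L : ℝ))
    (y e : H) :
    f (y - s • (∇ f y + e)) ≤ f y - s / 2 * ‖∇ f y‖ ^ 2
      - s / 4 * ‖∇ f (y - s • (∇ f y + e))‖ ^ 2 - s * inner ℝ (∇ f (y - s • ∇ f y)) e
      + s * ‖e‖ ^ 2 := by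
  have hL' : (0 : ℝ) < L := hL
  have hsL1 : s * L ≤ 1 := by rwa [le_div_iff₀ hL'] at hsL
  have hs2 : s / 2 ≤ 1 / (2 * (L : ℝ)) := by
    rw [div_le_div_iff₀ two_pos (by positivity)]; linarith
  set g := ∇ f y
  -- Passing through the noiseless step `u` makes the linear error term carry ∇f(u), which does not
  -- depend on e, instead of the gradient at `w`.
  set u := y - s • g with hu
  set w := y - s • (g + e) with hw
  have hwu : w - u = -(s • e) := by rw [hw, hu, smul_add]; abel
  have hyu : y - u = s • g := by rw [hu]; abel
  have h1 := hconv.add_inner_gradient_add_sq_le hdiff hL hlip u y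
  rw [hyu, inner_smul_right] at h1
  have h2 : s / 2 * ‖g - ∇ f u‖ ^ 2 ≤ 1 / (2 * L) * ‖g - ∇ f u‖ ^ 2 := by gcongr
  rw [norm_sub_sq_real, real_inner_comm] at h2
  have h3 := hlip.le_add_inner_gradient hdiff u w
  rw [hwu, inner_neg_right, inner_smul_right, norm_neg, norm_smul, mul_pow, Real.norm_eq_abs,
    sq_abs] at h3
  have h4 : ‖∇ f w - ∇ f u‖ ≤ ‖e‖ := by
    have := hlip.dist_le_mul w u
    rw [dist_eq_norm, dist_eq_norm, hwu, norm_neg, norm_smul, Real.norm_eq_abs,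
      abs_of_pos hs] at this
    nlinarith [norm_nonneg e]
  have h5 : ‖∇ f w‖ ^ 2 ≤ 2 * ‖∇ f u‖ ^ 2 + 2 * ‖e‖ ^ 2 := by
    have := norm_add_le (∇ f w - ∇ f u) (∇ f u)
    rw [sub_add_cancel] at this
    nlinarith [norm_nonneg (∇ f w), sq_nonneg (‖∇ f u‖ - ‖e‖), norm_nonneg (∇ f u), norm_nonneg e]
  have h6 : L / 2 * (s ^ 2 * ‖e‖ ^ 2) ≤ s / 2 * ‖e‖ ^ 2 := by
    have : (s * L) * (s * ‖e‖ ^ 2) ≤ 1 * (s * ‖e‖ ^ 2) := by gcongr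
    linarith
  have h7 : s / 4 * ‖∇ f w‖ ^ 2 ≤ s / 4 * (2 * ‖∇ f u‖ ^ 2 + 2 * ‖e‖ ^ 2) := by gcongr
  have h8 : 1 / (2 * (L : ℝ)) * ‖g - ∇ f u‖ ^ 2 ≥ s / 2 * (‖g‖ ^ 2 - 2 * inner ℝ (∇ f u) g
      + ‖∇ f u‖ ^ 2) := by
    have := h2; rw [norm_sub_sq_real, real_inner_comm]; linarith
  linarith

/-- The coefficient of the gradient error in the energy inequality for one inertial step. -/
noncomputable def inertialNoiseCoeff (f : H → ℝ) (l p s : ℝ) (z x y : H) : H :=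
  -(p * s) • (l • (x - z) + p • (y - x) - (p * s) • ∇ f y) - (p ^ 2 * s ^ 2) • ∇ f (y - s • ∇ f y)

/-- Energy inequality for one step of the inertial gradient scheme with extrapolated point `y`,
anchored at a point `z`. -/
theorem inertial_step_energy_le (hconv : ConvexOn ℝ Set.univ f) (hdiff : Differentiable ℝ f)
    (hL : 0 < L) (hlip : LipschitzWith L (∇ f)) {z : H}
    {s : ℝ} (hs : 0 < s) (hsL : s ≤ 1 / (L : ℝ)) {l p : ℝ} (hl : 0 ≤ l) (hlp : l ≤ p)
    (x y e : H) :
    p ^ 2 * s * (f (y - s • (∇ f y + e)) - f z)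
      + 1 / 2 * ‖l • (x - z) + p • (y - s • (∇ f y + e) - x)‖ ^ 2
      + p ^ 2 * s ^ 2 / 4 * ‖∇ f (y - s • (∇ f y + e))‖ ^ 2
      + p * (p - l) * s / (2 * L) * ‖∇ f y - ∇ f x‖ ^ 2 ≤
    1 / 2 * ‖l • (x - z) + p • (y - x)‖ ^ 2 + p * (p - l) * s * (f x - f z)
      + inner ℝ (inertialNoiseCoeff f l p s z x y) e
      + 2 * (p ^ 2 * s ^ 2) * ‖e‖ ^ 2 := by
  have hp : 0 ≤ p := hl.trans hlp
  rw [inertialNoiseCoeff]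
  have h1 := noisy_gradient_step_le hconv hdiff hL hlip hs hsL y e
  set g := ∇ f y
  set w := y - s • (g + e) with hw
  set u := y - s • g
  set m := l • (x - z) + p • (y - x) with hm
  have hu' : l • (x - z) + p • (w - x) = m - (p * s) • (g + e) := by
    rw [hm, hw, mul_smul, smul_sub p, smul_sub p, smul_sub p]; abel
  -- The weights l and p - l are nonnegative, so convexity at y can be used towards both z and x;
  -- the terms in f(y) then cancel against the descent inequality.
  have hmy : m = l • (y - z) + (p - l) • (y - x) := by
    rw [hm]; module
  have h2 := hconv.add_inner_gradient_le hdiff y z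
  have h3 := hconv.add_inner_gradient_add_sq_le hdiff hL hlip y x
  have hmg : inner ℝ m g = l * inner ℝ g (y - z) + (p - l) * inner ℝ g (y - x) := by
    rw [hmy, inner_add_left, inner_smul_left, inner_smul_left, real_inner_comm,
      real_inner_comm g (y - x)]
    simp
  rw [← neg_sub y z, inner_neg_right] at h2
  rw [← neg_sub y x, inner_neg_right, norm_sub_rev] at h3
  have h4 := mul_le_mul_of_nonneg_left h2 hl
  have h5 := mul_le_mul_of_nonneg_left h3 (sub_nonneg.2 hlp)
  have h6 : l * (f y - f z) + (p - l) * (f y - f x + 1 / (2 * L) * ‖g - ∇ f x‖ ^ 2)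
      ≤ inner ℝ m g := by rw [hmg]; linarith
  have h7 := mul_le_mul_of_nonneg_left h6 (mul_nonneg hp hs.le)
  have h8 := mul_le_mul_of_nonneg_left h1 (mul_nonneg (sq_nonneg p) hs.le)
  clear_value m
  rw [hu', norm_sub_sq_real, inner_smul_right, inner_add_right, norm_smul, mul_pow ‖p * s‖,
    Real.norm_eq_abs, sq_abs, norm_add_sq_real g e, inner_sub_left, inner_smul_left,
    inner_smul_left, inner_sub_left, inner_smul_left]
  have e1 : p * (p - l) * s / (2 * L) * ‖g - ∇ f x‖ ^ 2
      = p * s * ((p - l) * (1 / (2 * L) * ‖g - ∇ f x‖ ^ 2)) := by ring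
  rw [e1]
  -- The errors add up to 3/2 (1 from the gradient step, 1/2 from the square), rounded up to 2.
  have h9 : 0 ≤ p ^ 2 * s ^ 2 * ‖e‖ ^ 2 := by positivity
  simp only [conj_trivial]
  linarith [h7, h8, h9]

end SmoothConvex

/-! ### Supermartingale convergence without integrability. -/

section RobbinsSiegmund

variable {Ω : Type*} {m0 : MeasurableSpace Ω} {P : Measure Ω}

/-- A nonnegative process that is a supermartingale in the sense of the Lebesgue integral converges
almost surely. -/
theorem ae_exists_tendsto_of_setLIntegral_succ_le [IsFiniteMeasure P] (ℱ : Filtration ℕ m0)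
    {U : ℕ → Ω → ℝ} (hU : ∀ k, Measurable[ℱ k] (U k)) (hU0 : ∀ k ω, 0 ≤ U k ω)
    (hfin : ∫⁻ ω, ENNReal.ofReal (U 0 ω) ∂P ≠ ∞)
    (hle : ∀ k A, MeasurableSet[ℱ k] A →
      ∫⁻ ω in A, ENNReal.ofReal (U (k + 1) ω) ∂P ≤ ∫⁻ ω in A, ENNReal.ofReal (U k ω) ∂P) :
    ∀ᵐ ω ∂P, ∃ l, Tendsto (fun k => U k ω) atTop (𝓝 l) := by
  have hbd : ∀ k, ∫⁻ ω, ENNReal.ofReal (U k ω) ∂P ≤ ∫⁻ ω, ENNReal.ofReal (U 0 ω) ∂P := by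
    intro k
    induction k with
    | zero => exact le_rfl
    | succ k ih =>
      have := hle k Set.univ MeasurableSet.univ
      simp only [Measure.restrict_univ] at this
      exact this.trans ih
  have hmeas : ∀ k, Measurable (U k) := fun k => (hU k).mono (ℱ.le k) le_rfl
  have hint : ∀ k, Integrable (U k) P := fun k => by
    rw [← lintegral_ofReal_ne_top_iff_integrable (hmeas k).aestronglyMeasurable
      (ae_of_all _ (hU0 k))]
    exact ne_top_of_le_ne_top hfin (hbd k)
  have hsup : Supermartingale U ℱ P := by
    refine supermartingale_of_setIntegral_succ_le
      (fun k => (hU k).stronglyMeasurable) hint (fun k A hA => ?_)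
    rw [integral_eq_lintegral_of_nonneg_ae (ae_of_all _ (hU0 _))
        (hmeas _).aestronglyMeasurable,
      integral_eq_lintegral_of_nonneg_ae (ae_of_all _ (hU0 _)) (hmeas _).aestronglyMeasurable]
    refine ENNReal.toReal_mono ?_ (hle k A hA)
    exact ne_top_of_le_ne_top (ne_top_of_le_ne_top hfin (hbd k)) (setLIntegral_le_lintegral _ _)
  have := hsup.neg.exists_ae_tendsto_of_bdd
    (R := (∫⁻ ω, ENNReal.ofReal (U 0 ω) ∂P).toNNReal) (fun k => ?_)
  · filter_upwards [this] with ω hω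
    obtain ⟨c, hc⟩ := hω
    exact ⟨-c, by simpa using hc.neg⟩
  · rw [ENNReal.coe_toNNReal hfin, eLpNorm_one_eq_lintegral_enorm]
    refine le_trans (le_of_eq ?_) (hbd k)
    refine lintegral_congr fun ω => ?_
    rw [Pi.neg_apply, Pi.neg_apply, enorm_neg, Real.enorm_eq_ofReal (hU0 k ω)]

/-- Robbins–Siegmund convergence theorem, with the conditional inequality expressed through
Lebesgue integrals so that no integrability is required. -/
theorem robbins_siegmund_lintegral [IsFiniteMeasure P] (ℱ : Filtration ℕ m0)
    {V b c : ℕ → Ω → ℝ} (hV : ∀ k, Measurable[ℱ k] (V k)) (hb : ∀ k, Measurable[ℱ k] (b k))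
    (hc : ∀ k, Measurable[ℱ (k + 1)] (c k)) (hV0 : ∀ k ω, 0 ≤ V k ω) (hb0 : ∀ k ω, 0 ≤ b k ω)
    (hc0 : ∀ k ω, 0 ≤ c k ω) (hbs : ∀ᵐ ω ∂P, Summable fun k => b k ω)
    (hle : ∀ k A, MeasurableSet[ℱ k] A →
      ∫⁻ ω in A, ENNReal.ofReal (V (k + 1) ω + c k ω) ∂P ≤
        ∫⁻ ω in A, ENNReal.ofReal (V k ω + b k ω) ∂P) :
    ∀ᵐ ω ∂P, (∃ l, Tendsto (fun k => V k ω) atTop (𝓝 l)) ∧ Summable fun k => c k ω := by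
  have hsumb : ∀ k j, k ≤ j + 1 → Measurable[ℱ j] fun ω => ∑ i ∈ Finset.range k, b i ω := by
    intro k j hkj
    refine Finset.measurable_fun_sum _ fun i hi => (hb i).mono (ℱ.mono ?_) le_rfl
    have := Finset.mem_range.1 hi
    omega
  have hsumc : ∀ k, Measurable[ℱ k] fun ω => ∑ i ∈ Finset.range k, c i ω := by
    intro k
    refine Finset.measurable_fun_sum _ fun i hi => (hc i).mono (ℱ.mono ?_) le_rfl
    exact Finset.mem_range.1 hi
  -- Localisation: these events decrease in k and belong to the past, because b_k is already known
  -- at time k. Stopping on them replaces integrability of V_0 and of ∑ b_k.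
  let A : ℕ → ℕ → Set Ω := fun n k =>
    {ω | V 0 ω ≤ n} ∩ {ω | ∑ i ∈ Finset.range (k + 1), b i ω ≤ n}
  have hA : ∀ n k, MeasurableSet[ℱ k] (A n k) := fun n k =>
    MeasurableSet.inter
      (measurableSet_le ((hV 0).mono (ℱ.mono (Nat.zero_le k)) le_rfl) measurable_const)
      (measurableSet_le (hsumb _ _ le_rfl) measurable_const)
  have hAanti : ∀ n k, A n (k + 1) ⊆ A n k := fun n k ω hω => by
    refine ⟨hω.1, ?_⟩
    have h2 : ∑ i ∈ Finset.range (k + 1 + 1), b i ω ≤ n := hω.2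
    change ∑ i ∈ Finset.range (k + 1), b i ω ≤ n
    rw [Finset.sum_range_succ] at h2
    linarith [hb0 (k + 1) ω]
  -- Collecting the c_i and the unspent budget n - ∑ b_i turns the recursion into a supermartingale
  -- inequality; on `A n k` the budget is nonnegative and `W n 0` is at most 2n.
  let W : ℕ → ℕ → Ω → ℝ := fun n k ω => V k ω + ∑ i ∈ Finset.range k, c i ω
    + (n - ∑ i ∈ Finset.range k, b i ω)
  let U : ℕ → ℕ → Ω → ℝ := fun n k => (A n k).indicator (W n k)
  have hWm : ∀ n k, Measurable[ℱ k] (W n k) := fun n k =>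
    ((hV k).add (hsumc k)).add (measurable_const.sub (hsumb _ _ (Nat.le_succ k)))
  have hslack : ∀ n k, ∀ ω ∈ A n k, 0 ≤ (n : ℝ) - ∑ i ∈ Finset.range (k + 1), b i ω :=
    fun n k ω hω => sub_nonneg.2 hω.2
  have hW0 : ∀ n k, ∀ ω ∈ A n k, 0 ≤ W n k ω := fun n k ω hω => by
    have h1 := hslack n k ω hω
    rw [Finset.sum_range_succ] at h1
    have h2 : 0 ≤ ∑ i ∈ Finset.range k, c i ω := Finset.sum_nonneg fun i _ => hc0 i ω
    simp only [W]
    linarith [hV0 k ω, hb0 k ω]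
  have key : ∀ n, ∀ᵐ ω ∂P, ∃ l, Tendsto (fun k => U n k ω) atTop (𝓝 l) := by
    intro n
    refine ae_exists_tendsto_of_setLIntegral_succ_le ℱ (U := U n)
      (fun k => (hWm n k).indicator (hA n k))
      (fun k ω => Set.indicator_nonneg (hW0 n k) ω) ?_ ?_
    · refine ne_top_of_le_ne_top (b := ∫⁻ _, ENNReal.ofReal (2 * n) ∂P) ?_ (lintegral_mono ?_)
      · rw [lintegral_const]; finiteness
      · intro ω
        refine ENNReal.ofReal_le_ofReal ?_
        by_cases hω : ω ∈ A n 0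
        · have h1 : V 0 ω ≤ n := hω.1
          simp only [U, Set.indicator_of_mem hω, W]
          simp only [Finset.range_zero, Finset.sum_empty]
          linarith
        · simp only [U, Set.indicator_of_notMem hω]
          positivity
    · intro k B hB
      have hBA : MeasurableSet[ℱ k] (B ∩ A n k) := hB.inter (hA n k)
      have e1 : ∀ ω, ENNReal.ofReal (U n k ω)
          = (A n k).indicator (fun ω => ENNReal.ofReal (W n k ω)) ω := fun ω => by
        by_cases hω : ω ∈ A n k <;> simp [U, hω]
      have e2 : ∀ ω, ENNReal.ofReal (U n (k + 1) ω)
          ≤ (A n k).indicator (fun ω => ENNReal.ofReal (V (k + 1) ω + c k ω)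
            + ENNReal.ofReal (∑ i ∈ Finset.range k, c i ω
              + (n - ∑ i ∈ Finset.range (k + 1), b i ω))) ω := fun ω => by
        by_cases hω : ω ∈ A n (k + 1)
        · have hω' := hAanti n k hω
          rw [Set.indicator_of_mem hω', ← ENNReal.ofReal_add
            (add_nonneg (hV0 _ _) (hc0 _ _))
            (add_nonneg (Finset.sum_nonneg fun i _ => hc0 i ω) (hslack n k ω hω'))]
          simp only [U, Set.indicator_of_mem hω, W]
          rw [Finset.sum_range_succ (fun i => c i ω)]
          exact ENNReal.ofReal_le_ofReal (by linarith)
        · simp [U, hω]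
      have hm : Measurable fun ω => ENNReal.ofReal (∑ i ∈ Finset.range k, c i ω
          + (n - ∑ i ∈ Finset.range (k + 1), b i ω)) := by
        refine ENNReal.measurable_ofReal.comp
          (Measurable.mono (ma := ℱ k) ?_ (ℱ.le k) le_rfl)
        exact (hsumc k).add (measurable_const.sub (hsumb _ _ le_rfl))
      calc ∫⁻ ω in B, ENNReal.ofReal (U n (k + 1) ω) ∂P
          ≤ ∫⁻ ω in B, (A n k).indicator (fun ω => ENNReal.ofReal (V (k + 1) ω + c k ω)
            + ENNReal.ofReal (∑ i ∈ Finset.range k, c i ω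
              + (n - ∑ i ∈ Finset.range (k + 1), b i ω))) ω ∂P := lintegral_mono e2
        _ = ∫⁻ ω in B ∩ A n k, (ENNReal.ofReal (V (k + 1) ω + c k ω)
            + ENNReal.ofReal (∑ i ∈ Finset.range k, c i ω
              + (n - ∑ i ∈ Finset.range (k + 1), b i ω))) ∂P := by
          rw [setLIntegral_indicator (ℱ.le k _ (hA n k)), Set.inter_comm]
        _ ≤ ∫⁻ ω in B ∩ A n k, ENNReal.ofReal (W n k ω) ∂P := by
          rw [lintegral_add_right _ hm]
          refine (add_le_add_left (hle k _ hBA) _).trans ?_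
          rw [← lintegral_add_right _ hm]
          refine setLIntegral_mono' (ℱ.le k _ hBA) fun ω hω => ?_
          rw [← ENNReal.ofReal_add (add_nonneg (hV0 _ _) (hb0 _ _))
            (add_nonneg (Finset.sum_nonneg fun i _ => hc0 i ω) (hslack n k ω hω.2))]
          refine ENNReal.ofReal_le_ofReal ?_
          simp only [W, Finset.sum_range_succ]
          linarith
        _ = ∫⁻ ω in B, ENNReal.ofReal (U n k ω) ∂P := by
          simp_rw [e1]
          rw [setLIntegral_indicator (ℱ.le k _ (hA n k)), Set.inter_comm]
  filter_upwards [ae_all_iff.2 key, hbs] with ω hω hbω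
  obtain ⟨n, hn⟩ := exists_nat_ge (max (V 0 ω) (∑' k, b k ω))
  -- For n this large the trajectory never leaves the localising events, so the truncated process is
  -- `W` itself.
  have hmem : ∀ k, ω ∈ A n k := fun k =>
    ⟨(le_max_left _ _).trans hn,
      (hbω.sum_le_tsum _ (fun i _ => hb0 i ω)).trans ((le_max_right _ _).trans hn)⟩
  obtain ⟨l, hl⟩ := hω n
  have hWl : Tendsto (fun k => W n k ω) atTop (𝓝 l) := by
    refine hl.congr fun k => ?_
    simp only [U, Set.indicator_of_mem (hmem k)]
  have hVC : Tendsto (fun k => V k ω + ∑ i ∈ Finset.range k, c i ω) atTop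
      (𝓝 (l - (n - ∑' k, b k ω))) := by
    refine (hWl.sub (tendsto_const_nhds.sub hbω.hasSum.tendsto_sum_nat)).congr fun k => ?_
    simp only [W]; ring
  have hcs : Summable fun k => c k ω := by
    obtain ⟨M, hM⟩ := hVC.bddAbove_range
    refine summable_of_sum_range_le (c := M) (fun k => hc0 k ω) fun k => ?_
    have := hM (Set.mem_range_self k)
    linarith [hV0 k ω]
  refine ⟨⟨_, (hVC.sub hcs.hasSum.tendsto_sum_nat).congr fun k => ?_⟩, hcs⟩
  ring

end RobbinsSiegmund

/-! ### Averaging out the conditionally centred noise. -/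

section NoisyStep

variable {Ω : Type*} {m m0 : MeasurableSpace Ω} {P : Measure Ω}
  {H : Type*} [NormedAddCommGroup H] [InnerProductSpace ℝ H] [CompleteSpace H]

/-- A bounded `m`-measurable vector is orthogonal in mean to a conditionally centred one. -/
theorem setIntegral_inner_eq_zero_of_condExp_eq_zero [IsFiniteMeasure P] (hm : m ≤ m0)
    {ζ e : Ω → H} (hζ : StronglyMeasurable[m] ζ) (he : Integrable e P) (hz : P[e | m] =ᵐ[P] 0)
    {C : ℝ} {A : Set Ω} (hA : MeasurableSet[m] A) (hC : ∀ ω ∈ A, ‖ζ ω‖ ≤ C) :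
    IntegrableOn (fun ω => inner ℝ (ζ ω) (e ω)) A P ∧ ∫ ω in A, inner ℝ (ζ ω) (e ω) ∂P = 0 := by
  set ξ : Ω → H := A.indicator ζ with hξ
  have hξm : StronglyMeasurable[m] ξ := hζ.indicator hA
  have hξb : ∀ᵐ ω ∂P, ‖ξ ω‖ ≤ max C 0 := ae_of_all _ fun ω => by
    by_cases hω : ω ∈ A
    · rw [hξ, Set.indicator_of_mem hω]; exact (hC ω hω).trans (le_max_left _ _)
    · rw [hξ, Set.indicator_of_notMem hω, norm_zero]; exact le_max_right _ _
  have hint : Integrable (fun ω => inner ℝ (ξ ω) (e ω)) P :=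
    (innerSL ℝ).integrable_of_bilin_of_bdd_left _ (hξm.mono hm).aestronglyMeasurable hξb he
  have hpull := condExp_stronglyMeasurable_bilin_of_bound (innerSL ℝ) hm hξm he _ hξb
  have hAeq : ∀ ω ∈ A, inner ℝ (ξ ω) (e ω) = inner ℝ (ζ ω) (e ω) := fun ω hω => by
    rw [hξ, Set.indicator_of_mem hω]
  refine ⟨(hint.integrableOn (s := A)).congr_fun hAeq (hm _ hA), ?_⟩
  rw [← setIntegral_congr_fun (hm _ hA) hAeq, ← setIntegral_condExp hm hint hA]
  refine (setIntegral_congr_ae (hm _ hA) (g := fun _ => 0) ?_).trans (by simp)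
  filter_upwards [hpull, hz] with ω h1 h2 _
  have h1' : (P[fun ω => inner ℝ (ξ ω) (e ω) | m]) ω = inner ℝ (ξ ω) ((P[e | m]) ω) := h1
  rw [h1', h2]
  simp

/-- A pathwise inequality with centred noise and a quadratic error term gives an inequality of
Lebesgue integrals over events of the past. -/
theorem setLIntegral_le_of_noisy_le [IsFiniteMeasure P] (hm : m ≤ m0)
    {ζ e : Ω → H} (hζ : StronglyMeasurable[m] ζ) (he : Integrable e P) (hz : P[e | m] =ᵐ[P] 0)
    (hσ : ∀ᵐ ω ∂P, condLExp m P (fun ω => ‖e ω‖ₑ ^ 2) ω < ∞)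
    {V X : Ω → ℝ} (hV : Measurable[m] V) (hV0 : ∀ ω, 0 ≤ V ω) (hX0 : ∀ ω, 0 ≤ X ω)
    {q : ℝ} (hq : 0 ≤ q)
    (hle : ∀ ω, X ω ≤ V ω + inner ℝ (ζ ω) (e ω) + q * ‖e ω‖ ^ 2)
    {A : Set Ω} (hA : MeasurableSet[m] A) :
    ∫⁻ ω in A, ENNReal.ofReal (X ω) ∂P ≤
      ∫⁻ ω in A, ENNReal.ofReal
        (V ω + q * (condLExp m P (fun ω => ‖e ω‖ₑ ^ 2) ω).toReal) ∂P := by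
  set τ := condLExp m P (fun ω => ‖e ω‖ₑ ^ 2) with hτ
  have hτm : Measurable[m] τ := measurable_condLExp m P _
  have hem := he.aestronglyMeasurable
  have hesq : AEStronglyMeasurable (fun ω => ‖e ω‖ ^ 2) P := hem.norm.pow 2
  -- On these events of the past every term is integrable and the linear noise has mean zero. They
  -- exhaust Ω up to a null set, and continuity of Lebesgue integrals along increasing sets removes
  -- the truncation.
  let B : ℕ → Set Ω := fun j => {ω | ‖ζ ω‖ ≤ j} ∩ ({ω | V ω ≤ j} ∩ {ω | τ ω ≤ j})
  have hB : ∀ j, MeasurableSet[m] (B j) := fun j =>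
    (measurableSet_le hζ.norm.measurable measurable_const).inter
      ((measurableSet_le hV measurable_const).inter (measurableSet_le hτm measurable_const))
  have hBmono : Monotone B := fun i j hij ω hω => by
    have hij' : (i : ℝ) ≤ j := by exact_mod_cast hij
    have hij'' : (i : ℝ≥0∞) ≤ j := by exact_mod_cast hij
    exact ⟨le_trans hω.1 hij', le_trans hω.2.1 hij', le_trans hω.2.2 hij''⟩
  have hcov : ∀ᵐ ω ∂P, ω ∈ ⋃ j, B j := by
    filter_upwards [hσ] with ω hω
    obtain ⟨j, hj⟩ := exists_nat_ge (max (max ‖ζ ω‖ (V ω)) (τ ω).toReal)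
    refine Set.mem_iUnion.2 ⟨j, ?_, ?_, ?_⟩
    · exact ((le_max_left _ _).trans (le_max_left _ _)).trans hj
    · exact ((le_max_right _ _).trans (le_max_left _ _)).trans hj
    · have h1 := (le_max_right _ _).trans hj
      change τ ω ≤ j
      rw [← ENNReal.ofReal_toReal hω.ne, ← ENNReal.ofReal_natCast]
      exact ENNReal.ofReal_le_ofReal h1
  have hAeq : (⋃ j, A ∩ B j : Set Ω) =ᵐ[P] A := by
    rw [← Set.inter_iUnion]
    filter_upwards [hcov] with ω hω
    exact propext ⟨fun h => h.1, fun h => ⟨h, hω⟩⟩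
  have hstep : ∀ j, ∫⁻ ω in A ∩ B j, ENNReal.ofReal (X ω) ∂P ≤
      ∫⁻ ω in A ∩ B j, ENNReal.ofReal (V ω + q * (τ ω).toReal) ∂P := by
    intro j
    set D := A ∩ B j with hD
    have hDm : MeasurableSet[m] D := hA.inter (hB j)
    have hDm0 := hm _ hDm
    obtain ⟨hi, h0⟩ := setIntegral_inner_eq_zero_of_condExp_eq_zero hm hζ he hz hDm
      (C := j) (fun ω hω => hω.2.1)
    have hτfin : ∫⁻ ω in D, τ ω ∂P ≠ ∞ := by
      refine ne_top_of_le_ne_top (b := ∫⁻ _ in D, (j : ℝ≥0∞) ∂P) ?_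
        (setLIntegral_mono' hDm0 fun ω hω => hω.2.2.2)
      rw [setLIntegral_const]
      finiteness
    have hτe : ∫⁻ ω in D, τ ω ∂P = ∫⁻ ω in D, ‖e ω‖ₑ ^ 2 ∂P := setLIntegral_condLExp hm P _ hDm
    have hnorm : ∀ ω, ENNReal.ofReal (‖e ω‖ ^ 2) = ‖e ω‖ₑ ^ 2 := fun ω => by
      rw [ENNReal.ofReal_pow (norm_nonneg _), ofReal_norm]
    have hesqi : IntegrableOn (fun ω => ‖e ω‖ ^ 2) D P := by
      rw [IntegrableOn, ← lintegral_ofReal_ne_top_iff_integrable hesq.restrict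
        (ae_of_all _ fun ω => sq_nonneg _)]
      simp_rw [hnorm]
      rwa [← hτe]
    have hτi : IntegrableOn (fun ω => (τ ω).toReal) D P :=
      integrable_toReal_of_lintegral_ne_top (hτm.mono hm le_rfl).aemeasurable hτfin
    have hτint : ∫ ω in D, (τ ω).toReal ∂P = ∫ ω in D, ‖e ω‖ ^ 2 ∂P := by
      rw [integral_toReal (hτm.mono hm le_rfl).aemeasurable
          (ae_lt_top' (hτm.mono hm le_rfl).aemeasurable hτfin),
        integral_eq_lintegral_of_nonneg_ae (ae_of_all _ fun ω => sq_nonneg _) hesq.restrict]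
      simp_rw [hnorm]
      rw [hτe]
    have hVi : IntegrableOn V D P := by
      refine Measure.integrableOn_of_bounded (M := j) (measure_ne_top _ _)
        (hV.mono hm le_rfl).aestronglyMeasurable ?_
      refine (ae_restrict_iff' hDm0).2 (ae_of_all _ fun ω hω => ?_)
      rw [Real.norm_eq_abs, abs_of_nonneg (hV0 ω)]
      exact hω.2.2.1
    have hVi1 : IntegrableOn (fun ω => V ω + inner ℝ (ζ ω) (e ω) + q * ‖e ω‖ ^ 2) D P :=
      (hVi.add hi).add (hesqi.const_mul q)
    calc ∫⁻ ω in D, ENNReal.ofReal (X ω) ∂P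
        ≤ ∫⁻ ω in D, ENNReal.ofReal (V ω + inner ℝ (ζ ω) (e ω) + q * ‖e ω‖ ^ 2) ∂P :=
          lintegral_mono fun ω => ENNReal.ofReal_le_ofReal (hle ω)
      _ = ENNReal.ofReal (∫ ω in D, (V ω + inner ℝ (ζ ω) (e ω) + q * ‖e ω‖ ^ 2) ∂P) :=
          (ofReal_integral_eq_lintegral_ofReal hVi1
            (ae_of_all _ fun ω => (hX0 ω).trans (hle ω))).symm
      _ = ENNReal.ofReal (∫ ω in D, (V ω + q * (τ ω).toReal) ∂P) := by
          have e1 : ∫ ω in D, (V ω + inner ℝ (ζ ω) (e ω) + q * ‖e ω‖ ^ 2) ∂P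
              = ∫ ω in D, (V ω + inner ℝ (ζ ω) (e ω)) ∂P + ∫ ω in D, q * ‖e ω‖ ^ 2 ∂P :=
            integral_add (hVi.add hi) (hesqi.const_mul q)
          rw [e1, integral_add hVi hi, h0, integral_const_mul,
            integral_add hVi (hτi.const_mul q), integral_const_mul, hτint, add_zero]
      _ = ∫⁻ ω in D, ENNReal.ofReal (V ω + q * (τ ω).toReal) ∂P :=
          ofReal_integral_eq_lintegral_ofReal (hVi.add (hτi.const_mul q))
            (ae_of_all _ fun ω => add_nonneg (hV0 ω) (mul_nonneg hq ENNReal.toReal_nonneg))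
  have hdir : Directed (· ⊆ ·) fun j => A ∩ B j :=
    Monotone.directed_le fun i j hij => Set.inter_subset_inter_right _ (hBmono hij)
  rw [← setLIntegral_congr hAeq, setLIntegral_iUnion_of_directed _ hdir]
  refine iSup_le fun j => (hstep j).trans ?_
  exact lintegral_mono_set Set.inter_subset_left

end NoisyStep

/-! ### Robbins–Siegmund for noisy pathwise recursions. -/

section RobbinsSiegmundNoisy

variable {Ω : Type*} {m0 : MeasurableSpace Ω} {P : Measure Ω}
  {H : Type*} [NormedAddCommGroup H] [InnerProductSpace ℝ H] [CompleteSpace H]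

theorem exists_tendsto_prod_one_add {a : ℕ → ℝ} (ha0 : ∀ k, 0 ≤ a k) (has : Summable a) :
    ∃ l, Tendsto (fun k => ∏ i ∈ Finset.range k, (1 + a i)) atTop (𝓝 l) := by
  have hmono : Monotone fun k => ∏ i ∈ Finset.range k, (1 + a i) := by
    refine monotone_nat_of_le_succ fun k => ?_
    rw [Finset.prod_range_succ]
    refine le_mul_of_one_le_right (Finset.prod_nonneg fun i _ => ?_) ?_
    · linarith [ha0 i]
    · linarith [ha0 k]
  refine ⟨_, tendsto_atTop_ciSup hmono ⟨Real.exp (∑' i, a i), ?_⟩⟩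
  rintro _ ⟨k, rfl⟩
  calc ∏ i ∈ Finset.range k, (1 + a i) ≤ ∏ i ∈ Finset.range k, Real.exp (a i) := by
        refine Finset.prod_le_prod (fun i _ => by linarith [ha0 i]) fun i _ => ?_
        linarith [Real.add_one_le_exp (a i)]
    _ = Real.exp (∑ i ∈ Finset.range k, a i) := (Real.exp_sum _ _).symm
    _ ≤ _ := Real.exp_le_exp.2 (has.sum_le_tsum _ fun i _ => ha0 i)

/-- Robbins–Siegmund theorem for a nonnegative process satisfying, from some index on, a pathwise
recursion driven by conditionally centred noise with finite conditional variance. -/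
theorem robbins_siegmund_noisy [IsFiniteMeasure P] (ℱ : Filtration ℕ m0) (N : ℕ)
    {V b c : ℕ → Ω → ℝ} (hV : ∀ k, Measurable[ℱ k] (V k)) (hb : ∀ k, Measurable[ℱ k] (b k))
    (hc : ∀ k, Measurable[ℱ (k + 1)] (c k)) (hV0 : ∀ k ω, 0 ≤ V k ω) (hb0 : ∀ k ω, 0 ≤ b k ω)
    (hc0 : ∀ k, N ≤ k → ∀ ω, 0 ≤ c k ω) {a : ℕ → ℝ} (ha0 : ∀ k, 0 ≤ a k) (has : Summable a)
    {ζ e : ℕ → Ω → H} (hζ : ∀ k, StronglyMeasurable[ℱ k] (ζ k)) (he : ∀ k, Integrable (e k) P)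
    (hz : ∀ k, P[e k | ℱ k] =ᵐ[P] 0)
    (hσ : ∀ k, ∀ᵐ ω ∂P, condLExp (ℱ k) P (fun ω => ‖e k ω‖ₑ ^ 2) ω < ∞)
    {q : ℕ → ℝ} (hq : ∀ k, 0 ≤ q k) (hbs : ∀ᵐ ω ∂P, Summable fun k => b k ω)
    (hqs : ∀ᵐ ω ∂P, Summable fun k =>
      q k * (condLExp (ℱ k) P (fun ω => ‖e k ω‖ₑ ^ 2) ω).toReal)
    (hle : ∀ k, N ≤ k → ∀ ω, V (k + 1) ω + c k ω ≤
      (1 + a k) * V k ω + b k ω + inner ℝ (ζ k ω) (e k ω) + q k * ‖e k ω‖ ^ 2) :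
    ∀ᵐ ω ∂P, (∃ l, Tendsto (fun k => V k ω) atTop (𝓝 l)) ∧ Summable fun k => c k ω := by
  -- The recursion only holds from index N on, so time is shifted by N.
  let 𝒢 : Filtration ℕ m0 :=
    { seq := fun k => ℱ (k + N)
      mono' := fun i j hij => ℱ.mono (Nat.add_le_add_right hij N)
      le' := fun k => ℱ.le _ }
  -- Dividing by `ρ` absorbs the factors 1 + a_k; as `ρ` lies between 1 and a finite bound, neither
  -- convergence nor summability is affected.
  set ρ : ℕ → ℝ := fun k => ∏ i ∈ Finset.range k, (1 + a (i + N)) with hρ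
  have has' : Summable fun i => a (i + N) := (summable_nat_add_iff N).2 has
  have hρ1 : ∀ k, 0 < ρ k := fun k => Finset.prod_pos fun i _ => by linarith [ha0 (i + N)]
  have hρs : ∀ k, ρ (k + 1) = ρ k * (1 + a (k + N)) := fun k => Finset.prod_range_succ _ _
  obtain ⟨l, hl⟩ := exists_tendsto_prod_one_add (fun k => ha0 (k + N)) has'
  obtain ⟨M, hM⟩ := hl.bddAbove_range
  have hρM : ∀ k, ρ k ≤ M := fun k => hM (Set.mem_range_self k)
  have hρinv : ∀ k, (ρ k)⁻¹ ≤ 1 := fun k =>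
    inv_le_one_of_one_le₀ (Finset.one_le_prod fun i _ => by simp [ha0 (i + N)])
  let τ : ℕ → Ω → ℝ := fun k ω => (condLExp (ℱ k) P (fun ω => ‖e k ω‖ₑ ^ 2) ω).toReal
  have hτ : ∀ k, Measurable[ℱ k] (τ k) := fun k =>
    ENNReal.measurable_toReal.comp (measurable_condLExp (ℱ k) P _)
  have main := robbins_siegmund_lintegral (P := P) 𝒢
    (V := fun k ω => (ρ k)⁻¹ * V (k + N) ω)
    (b := fun k ω => (ρ (k + 1))⁻¹ * (b (k + N) ω + q (k + N) * τ (k + N) ω))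
    (c := fun k ω => (ρ (k + 1))⁻¹ * c (k + N) ω)
    (fun k => (hV (k + N)).const_mul _)
    (fun k => ((hb (k + N)).add ((hτ (k + N)).const_mul _)).const_mul _)
    (fun k => by
      have := (hc (k + N)).const_mul (ρ (k + 1))⁻¹
      rwa [add_right_comm] at this)
    (fun k ω => mul_nonneg (inv_pos.2 (hρ1 k)).le (hV0 _ _))
    (fun k ω => mul_nonneg (inv_pos.2 (hρ1 _)).le
      (add_nonneg (hb0 _ _) (mul_nonneg (hq _) ENNReal.toReal_nonneg)))
    (fun k ω => mul_nonneg (inv_pos.2 (hρ1 _)).le (hc0 _ (Nat.le_add_left _ _) _))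
    ?_ ?_
  · filter_upwards [main] with ω hω
    obtain ⟨⟨v, hv⟩, hcs⟩ := hω
    constructor
    · refine ⟨l * v, (tendsto_add_atTop_iff_nat N).1 ((hl.mul hv).congr fun k => ?_)⟩
      exact mul_inv_cancel_left₀ (hρ1 k).ne' _
    · refine (summable_nat_add_iff N).1 (Summable.of_nonneg_of_le
        (fun k => hc0 _ (Nat.le_add_left _ _) _) (fun k => ?_) (hcs.mul_left M))
      have h1 : c (k + N) ω = ρ (k + 1) * ((ρ (k + 1))⁻¹ * c (k + N) ω) :=
        (mul_inv_cancel_left₀ (hρ1 _).ne' _).symm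
      calc c (k + N) ω = ρ (k + 1) * ((ρ (k + 1))⁻¹ * c (k + N) ω) := h1
        _ ≤ M * ((ρ (k + 1))⁻¹ * c (k + N) ω) := mul_le_mul_of_nonneg_right (hρM _)
            (mul_nonneg (inv_pos.2 (hρ1 _)).le (hc0 _ (Nat.le_add_left _ _) _))
  · filter_upwards [hbs, hqs] with ω h1 h2
    have h3 := (summable_nat_add_iff N).2 (h1.add h2)
    refine Summable.of_nonneg_of_le (fun k => mul_nonneg (inv_pos.2 (hρ1 _)).le
      (add_nonneg (hb0 _ _) (mul_nonneg (hq _) ENNReal.toReal_nonneg))) (fun k => ?_) h3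
    exact mul_le_of_le_one_left
      (add_nonneg (hb0 _ _) (mul_nonneg (hq _) ENNReal.toReal_nonneg)) (hρinv _)
  · intro k A hA
    have hρe : (ρ (k + 1))⁻¹ * (1 + a (k + N)) = (ρ k)⁻¹ := by
      have : (0 : ℝ) < 1 + a (k + N) := by linarith [ha0 (k + N)]
      rw [hρs, mul_inv, mul_assoc, inv_mul_cancel₀ this.ne', mul_one]
    have hi := (inv_pos.2 (hρ1 (k + 1))).le
    have := setLIntegral_le_of_noisy_le (P := P) (ℱ.le (k + N))
      (ζ := fun ω => (ρ (k + 1))⁻¹ • ζ (k + N) ω) ((hζ (k + N)).const_smul _) (he (k + N))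
      (hz (k + N)) (hσ (k + N))
      (V := fun ω => (ρ k)⁻¹ * V (k + N) ω + (ρ (k + 1))⁻¹ * b (k + N) ω)
      (X := fun ω => (ρ (k + 1))⁻¹ * V (k + 1 + N) ω + (ρ (k + 1))⁻¹ * c (k + N) ω)
      (((hV (k + N)).const_mul _).add ((hb (k + N)).const_mul _))
      (fun ω => add_nonneg (mul_nonneg (inv_pos.2 (hρ1 k)).le (hV0 _ _))
        (mul_nonneg hi (hb0 _ _)))
      (fun ω => add_nonneg (mul_nonneg hi (hV0 _ _))
        (mul_nonneg hi (hc0 _ (Nat.le_add_left _ _) _)))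
      (q := (ρ (k + 1))⁻¹ * q (k + N)) (mul_nonneg hi (hq _))
      (fun ω => ?_) hA
    · refine this.trans (le_of_eq (lintegral_congr fun ω => ?_))
      congr 1
      simp only [τ]
      ring
    · have h1 := mul_le_mul_of_nonneg_left (hle (k + N) (Nat.le_add_left _ _) ω) hi
      rw [add_right_comm k 1 N, inner_smul_left, ← hρe]
      simp only [conj_trivial]
      linarith

end RobbinsSiegmundNoisy

/-! ### Lyapunov inequalities for one step. -/

section InertialEnergy

variable {H : Type*} [NormedAddCommGroup H] [InnerProductSpace ℝ H]

/-- The Lyapunov energy of an inertial scheme at consecutive iterates `x₀`, `x₁`, with step size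
`s`, weight `p` and anchoring parameter `l`. -/
noncomputable def inertialEnergy (f : H → ℝ) (l p s : ℝ) (z x₀ x₁ : H) : ℝ :=
  s * p ^ 2 * (f x₁ - f z) + 1 / 2 * ‖l • (x₀ - z) + p • (x₁ - x₀)‖ ^ 2
    + 1 / 2 * l ^ 2 * ‖x₀ - z‖ ^ 2

theorem inertialEnergy_nonneg {f : H → ℝ} {z : H} (hz : IsMinOn f Set.univ z) (l p : ℝ) {s : ℝ}
    (hs : 0 ≤ s) (x₀ x₁ : H) : 0 ≤ inertialEnergy f l p s z x₀ x₁ := by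
  have : 0 ≤ f x₁ - f z := sub_nonneg.2 (hz (Set.mem_univ _))
  unfold inertialEnergy
  positivity

/-- With h = x₀ - z, v = x₁ - x₀ and d = p' - p, the friction 2l and the anchor term ½ l²‖·‖² are
matched so that the cross terms ⟨h, v⟩ cancel up to l d⟨h, v⟩. Young's inequality splits this
remainder into l d²/p ‖h‖², which stays as the error, and l p/4 ‖v‖², which friction absorbs. -/
theorem anchored_part_le {l p p' : ℝ} (hl : 0 < l) (hpp : p ≤ p') (hd : p' - p ≤ l / 4)
    (hp1 : 1 ≤ p) (hpl : 4 * l ≤ p) (z x₀ x₁ : H) :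
    1 / 2 * ‖l • (x₁ - z) + (p' - 2 * l) • (x₁ - x₀)‖ ^ 2 + 1 / 2 * l ^ 2 * ‖x₁ - z‖ ^ 2
      + l / 4 * p * ‖x₁ - x₀‖ ^ 2 ≤
    1 / 2 * ‖l • (x₀ - z) + p • (x₁ - x₀)‖ ^ 2 + 1 / 2 * l ^ 2 * ‖x₀ - z‖ ^ 2
      + l * ((p' - p) ^ 2 / p) * ‖x₀ - z‖ ^ 2 := by
  have hp0 : 0 < p := by linarith
  obtain ⟨v, hv⟩ : ∃ v, v = x₁ - x₀ := ⟨_, rfl⟩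
  obtain ⟨h, hh⟩ : ∃ h, h = x₀ - z := ⟨_, rfl⟩
  have e1 : x₁ - z = h + v := by rw [hv, hh]; abel
  obtain ⟨d, hd'⟩ : ∃ d, d = p' - p := ⟨_, rfl⟩
  have e2 : l • (h + v) + (p' - 2 * l) • v = l • h + (p + d - l) • v := by
    rw [hd']; module
  rw [e1, ← hv, ← hh, e2, ← hd']
  have hd0 : 0 ≤ d := by linarith
  have hexp : ∀ c : ℝ, ‖l • h + c • v‖ ^ 2
      = l ^ 2 * ‖h‖ ^ 2 + 2 * (l * c * inner ℝ h v) + c ^ 2 * ‖v‖ ^ 2 := fun c => by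
    rw [norm_add_sq_real, norm_smul, norm_smul, mul_pow, mul_pow, Real.norm_eq_abs,
      Real.norm_eq_abs, sq_abs, sq_abs, inner_smul_left, inner_smul_right]
    simp only [conj_trivial]
    ring
  rw [hexp, hexp, norm_add_sq_real]
  have ht : inner ℝ h v ≤ ‖h‖ * ‖v‖ := real_inner_le_norm h v
  have hag : d * (‖h‖ * ‖v‖) ≤ d ^ 2 / p * ‖h‖ ^ 2 + p / 4 * ‖v‖ ^ 2 := by
    have h1 : 0 ≤ 1 / p * (d * ‖h‖ - p / 2 * ‖v‖) ^ 2 := by positivity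
    have h2 : 1 / p * (d * ‖h‖ - p / 2 * ‖v‖) ^ 2
        = d ^ 2 / p * ‖h‖ ^ 2 + p / 4 * ‖v‖ ^ 2 - d * (‖h‖ * ‖v‖) := by field_simp; ring
    linarith
  have h3 : d * inner ℝ h v ≤ d ^ 2 / p * ‖h‖ ^ 2 + p / 4 * ‖v‖ ^ 2 :=
    (mul_le_mul_of_nonneg_left ht hd0).trans hag
  have h4 := mul_le_mul_of_nonneg_left h3 hl.le
  -- Since d ≤ l/4, friction gives at least ¾ l p; half of l p pays for Young and the decrease term,
  -- and 4l ≤ p lets the remaining quarter dominate the l² terms.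
  have h5 : (1 / 2 * l ^ 2 + 1 / 2 * (l - d) ^ 2 - (l - d) * p + l * p / 4 + l / 4 * p)
      * ‖v‖ ^ 2 ≤ 0 := by
    refine mul_nonpos_of_nonpos_of_nonneg ?_ (sq_nonneg _)
    have hd4 : d ≤ l / 4 := by rw [hd']; exact hd
    nlinarith [mul_nonneg hd0 hp0.le, mul_le_mul_of_nonneg_right hd4 hp0.le,
      mul_le_mul_of_nonneg_left hpl hl.le]
  linarith

variable [CompleteSpace H] {f : H → ℝ} {L : ℝ≥0}

/-- The quantity by which the anchored energy decreases in one step. -/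
noncomputable def inertialDecrease (f : H → ℝ) (L l p p' s₀ s : ℝ) (z x₀ x₁ y x₂ : H) : ℝ :=
  p' ^ 2 * s ^ 2 / 4 * ‖∇ f x₂‖ ^ 2 + p' * (p' - l) * s / (2 * L) * ‖∇ f y - ∇ f x₁‖ ^ 2
    + l / 4 * p * ‖x₁ - x₀‖ ^ 2 + min 1 (l / 2) * p * s₀ * (f x₁ - f z)

/-- One step of the anchored energy. -/
theorem inertialEnergy_add_decrease_le (hconv : ConvexOn ℝ Set.univ f) (hdiff : Differentiable ℝ f)
    (hL : 0 < L) (hlip : LipschitzWith L (∇ f)) {z : H} (hz : IsMinOn f Set.univ z)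
    {s₀ s : ℝ} (hs : 0 < s) (hss : s ≤ s₀) (hsL : s ≤ 1 / (L : ℝ))
    {l p p' a : ℝ} (hl : 0 < l) (hpp : p ≤ p') (hd : p' - p ≤ l / 4) (hp1 : 1 ≤ p)
    (hpl : 4 * l ≤ p) (ha : p' * a = p' - 2 * l) {x₀ x₁ y : H} (hy : y = x₁ + a • (x₁ - x₀))
    (e : H) :
    inertialEnergy f l p' s z x₁ (y - s • (∇ f y + e))
      + inertialDecrease f L l p p' s₀ s z x₀ x₁ y (y - s • (∇ f y + e)) ≤
    (1 + 2 / l * ((p' - p) ^ 2 / p)) * inertialEnergy f l p s₀ z x₀ x₁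
      + inner ℝ (inertialNoiseCoeff f l p' s z x₁ y) e + 2 * (p' ^ 2 * s ^ 2) * ‖e‖ ^ 2 := by
  have hp0 : 0 < p := by linarith
  have h1 := inertial_step_energy_le hconv hdiff hL hlip (z := z) hs hsL hl.le
    (show l ≤ p' by linarith) x₁ y e
  have h2 := anchored_part_le hl hpp hd hp1 hpl z x₀ x₁
  have e1 : p' • (y - x₁) = (p' - 2 * l) • (x₁ - x₀) := by
    rw [hy, add_sub_cancel_left, smul_smul, ha]
  rw [e1] at h1
  have hF : 0 ≤ f x₁ - f z := sub_nonneg.2 (hz (Set.mem_univ _))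
  -- In the minimum, 1 serves the part s₀ - s lost when the step shrinks, and l/2 is what l p'
  -- leaves after paying for p'² - p² ≤ l p'/2.
  have h3 : p' * (p' - l) * s + min 1 (l / 2) * p * s₀ ≤ s₀ * p ^ 2 := by
    have hκ1 : min 1 (l / 2) ≤ 1 := min_le_left _ _
    have hκ2 : min 1 (l / 2) ≤ l / 2 := min_le_right _ _
    have hk0 : 0 < min 1 (l / 2) := lt_min one_pos (by linarith)
    set κ := min 1 (l / 2)
    have i1 : (s₀ - s) * (κ * p) ≤ (s₀ - s) * p ^ 2 := by
      refine mul_le_mul_of_nonneg_left ?_ (by linarith)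
      nlinarith
    have i2 : κ * p ≤ p ^ 2 - p' ^ 2 + l * p' := by
      have j1 : (p' - p) * (p + p') ≤ l / 4 * (2 * p') :=
        mul_le_mul hd (by linarith) (by linarith) (by linarith)
      have j2 : κ * p ≤ l / 2 * p' := mul_le_mul hκ2 hpp hp0.le (by linarith)
      nlinarith
    have i3 := mul_le_mul_of_nonneg_left i2 hs.le
    nlinarith
  have h4 := mul_le_mul_of_nonneg_right h3 hF
  have h5 : l * ((p' - p) ^ 2 / p) * ‖x₀ - z‖ ^ 2
      ≤ 2 / l * ((p' - p) ^ 2 / p) * inertialEnergy f l p s₀ z x₀ x₁ := by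
    have : l * ((p' - p) ^ 2 / p) * ‖x₀ - z‖ ^ 2
        = 2 / l * ((p' - p) ^ 2 / p) * (1 / 2 * l ^ 2 * ‖x₀ - z‖ ^ 2) := by
      field_simp
    rw [this]
    refine mul_le_mul_of_nonneg_left ?_ (by positivity)
    unfold inertialEnergy
    have hs0 : 0 < s₀ := by linarith
    have : 0 ≤ s₀ * p ^ 2 * (f x₁ - f z) := by positivity
    have : 0 ≤ 1 / 2 * ‖l • (x₀ - z) + p • (x₁ - x₀)‖ ^ 2 := by positivity
    linarith
  rw [add_mul, one_mul]
  refine le_trans ?_ (add_le_add_left (add_le_add_left (add_le_add_right h5 _) _) _)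
  unfold inertialEnergy inertialDecrease
  linarith

/-- One step of the energy without anchor. -/
theorem inertialEnergy_zero_le (hconv : ConvexOn ℝ Set.univ f) (hdiff : Differentiable ℝ f)
    (hL : 0 < L) (hlip : LipschitzWith L (∇ f)) {z : H} (hz : IsMinOn f Set.univ z)
    {s₀ s : ℝ} (hs : 0 < s) (hss : s ≤ s₀) (hsL : s ≤ 1 / (L : ℝ))
    {α p p' a : ℝ} (hα : 0 ≤ α) (hpp : p ≤ p') (hd : p' - p ≤ α) (hd1 : p' - p ≤ 1) (hp1 : 1 ≤ p)
    (hpα : α ≤ p) (ha : p' * a = p' - α) {x₀ x₁ y : H}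
    (hy : y = x₁ + a • (x₁ - x₀)) (e : H) :
    inertialEnergy f 0 p' s z x₁ (y - s • (∇ f y + e)) ≤
    inertialEnergy f 0 p s₀ z x₀ x₁ + 4 * (p * s₀ * (f x₁ - f z))
      + inner ℝ (inertialNoiseCoeff f 0 p' s z x₁ y) e + 2 * (p' ^ 2 * s ^ 2) * ‖e‖ ^ 2 := by
  have hp0 : 0 < p := by linarith
  have hs0 : 0 < s₀ := by linarith
  have h1 := inertial_step_energy_le hconv hdiff hL hlip (z := z) hs hsL le_rfl
    (show 0 ≤ p' by linarith) x₁ y e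
  have e1 : p' • (y - x₁) = (p' - α) • (x₁ - x₀) := by
    rw [hy, add_sub_cancel_left, smul_smul, ha]
  rw [e1] at h1
  have hF : 0 ≤ f x₁ - f z := sub_nonneg.2 (hz (Set.mem_univ _))
  -- From p' ≤ p + 1 and p ≥ 1; the excess is not absorbed but left to be summed separately.
  have h2 : p' ^ 2 * s ≤ s₀ * p ^ 2 + 4 * (p * s₀) := by
    have i1 : p' ^ 2 ≤ p ^ 2 + 4 * p := by nlinarith
    have i2 : p' ^ 2 * s ≤ (p ^ 2 + 4 * p) * s₀ := mul_le_mul i1 hss hs.le (by positivity)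
    linarith
  have h3 := mul_le_mul_of_nonneg_right h2 hF
  have h4 : (p' - α) ^ 2 * ‖x₁ - x₀‖ ^ 2 ≤ p ^ 2 * ‖x₁ - x₀‖ ^ 2 := by
    refine mul_le_mul_of_nonneg_right ?_ (sq_nonneg _)
    exact pow_le_pow_left₀ (by linarith) (by linarith) 2
  have h5 : 0 ≤ p' ^ 2 * s ^ 2 / 4 * ‖∇ f (y - s • (∇ f y + e))‖ ^ 2 := by positivity
  have h6 : 0 ≤ p' * (p' - 0) * s / (2 * L) * ‖∇ f y - ∇ f x₁‖ ^ 2 := by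
    rw [sub_zero, ← sq]; positivity
  unfold inertialEnergy
  simp only [zero_smul, zero_add, norm_smul, mul_pow, Real.norm_eq_abs, sq_abs] at h1 ⊢
  linarith

end InertialEnergy

/-! ### The weights n^r. -/

section PowerWeights

variable {r : ℝ}

theorem natCast_rpow_le_succ (hr : r ∈ Set.Ioo (0 : ℝ) 1) (n : ℕ) :
    (n : ℝ) ^ r ≤ ((n + 1 : ℕ) : ℝ) ^ r :=
  Real.rpow_le_rpow n.cast_nonneg (by exact_mod_cast n.le_succ) hr.1.le

theorem natCast_rpow_succ_sub_le (hr : r ∈ Set.Ioo (0 : ℝ) 1) {n : ℕ} (hn : 1 ≤ n) :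
    ((n + 1 : ℕ) : ℝ) ^ r - (n : ℝ) ^ r ≤ (n : ℝ) ^ (r - 1) := by
  have hn0 : (0 : ℝ) < n := by exact_mod_cast hn
  have h1 : ((n + 1 : ℕ) : ℝ) = n * (1 + 1 / n) := by push_cast; field_simp
  have h2 : (1 + 1 / (n : ℝ)) ^ r ≤ 1 + r * (1 / n) :=
    rpow_one_add_le_one_add_mul_self
      (by have : 0 ≤ 1 / (n : ℝ) := by positivity
          linarith) hr.1.le hr.2.le
  rw [h1, Real.mul_rpow hn0.le (by positivity), Real.rpow_sub_one hn0.ne']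
  have h3 := mul_le_mul_of_nonneg_left h2 (Real.rpow_nonneg hn0.le r)
  have h4 : r * ((n : ℝ) ^ r / n) ≤ 1 * ((n : ℝ) ^ r / n) := by
    have := hr.2.le; gcongr
  have h5 : (n : ℝ) ^ r * (1 + r * (1 / n)) = (n : ℝ) ^ r + r * ((n : ℝ) ^ r / n) := by ring
  linarith

theorem one_le_natCast_rpow (hr : r ∈ Set.Ioo (0 : ℝ) 1) {n : ℕ} (hn : 1 ≤ n) :
    1 ≤ (n : ℝ) ^ r :=
  Real.one_le_rpow (by exact_mod_cast hn) hr.1.le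

theorem natCast_rpow_sub_one_le_one (hr : r ∈ Set.Ioo (0 : ℝ) 1) {n : ℕ} (hn : 1 ≤ n) :
    (n : ℝ) ^ (r - 1) ≤ 1 :=
  Real.rpow_le_one_of_one_le_of_nonpos (by exact_mod_cast hn) (by linarith [hr.2])

theorem natCast_rpow_succ_le_two_mul (hr : r ∈ Set.Ioo (0 : ℝ) 1) {n : ℕ} (hn : 1 ≤ n) :
    ((n + 1 : ℕ) : ℝ) ^ r ≤ 2 * (n : ℝ) ^ r := by
  linarith [natCast_rpow_succ_sub_le hr hn, natCast_rpow_sub_one_le_one hr hn,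
    one_le_natCast_rpow hr hn]

theorem tendsto_natCast_rpow_atTop (hr : r ∈ Set.Ioo (0 : ℝ) 1) :
    Tendsto (fun n : ℕ => (n : ℝ) ^ r) atTop atTop :=
  (tendsto_rpow_atTop hr.1).comp tendsto_natCast_atTop_atTop

theorem eventually_natCast_rpow_succ_sub_le (hr : r ∈ Set.Ioo (0 : ℝ) 1) {ε : ℝ} (hε : 0 < ε) :
    ∀ᶠ n : ℕ in atTop, ((n + 1 : ℕ) : ℝ) ^ r - (n : ℝ) ^ r ≤ ε := by
  have h : Tendsto (fun n : ℕ => (n : ℝ) ^ (r - 1)) atTop (𝓝 0) := by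
    have := (tendsto_rpow_neg_atTop (show 0 < 1 - r by linarith [hr.2])).comp
      tendsto_natCast_atTop_atTop
    simpa [Function.comp_def] using this
  filter_upwards [h.eventually_le_const hε, eventually_ge_atTop 1] with n h1 h2
  exact (natCast_rpow_succ_sub_le hr h2).trans h1

/-- The increments are at most n^{r-1}, so the terms are at most n^{r-2}, and r < 1 suffices. -/
theorem summable_natCast_rpow_sub_sq_div (hr : r ∈ Set.Ioo (0 : ℝ) 1) :
    Summable fun n : ℕ => (((n + 1 : ℕ) : ℝ) ^ r - (n : ℝ) ^ r) ^ 2 / (n : ℝ) ^ r := by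
  have hs : Summable fun n : ℕ => (n : ℝ) ^ (r - 2) :=
    Real.summable_nat_rpow.2 (by linarith [hr.2])
  refine Summable.of_nonneg_of_le (fun n => by positivity) (fun n => ?_) hs
  -- At n = 0 the weight vanishes and the quotient is 0 by the division convention.
  rcases Nat.eq_zero_or_pos n with rfl | hn
  · rw [Nat.cast_zero, Real.zero_rpow hr.1.ne', div_zero]
    exact Real.rpow_nonneg le_rfl _
  · have hn0 : (0 : ℝ) < n := by exact_mod_cast hn
    have h1 : (((n + 1 : ℕ) : ℝ) ^ r - (n : ℝ) ^ r) ^ 2 ≤ ((n : ℝ) ^ (r - 1)) ^ 2 :=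
      pow_le_pow_left₀ (sub_nonneg.2 (natCast_rpow_le_succ hr n)) (natCast_rpow_succ_sub_le hr hn) 2
    rw [div_le_iff₀ (Real.rpow_pos_of_pos hn0 r)]
    refine h1.trans (le_of_eq ?_)
    rw [← Real.rpow_add hn0, ← Real.rpow_natCast, ← Real.rpow_mul hn0.le]
    congr 1
    push_cast
    ring

/-- A positive limit would force ∑ n^{-r} to converge, which fails for r < 1. This is what upgrades
boundedness to little-o. -/
theorem tendsto_zero_of_summable_div_rpow (hr : r ∈ Set.Ioo (0 : ℝ) 1) {G : ℕ → ℝ} {l : ℝ}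
    (hG0 : ∀ n, 0 ≤ G n) (hG : Tendsto G atTop (𝓝 l))
    (hs : Summable fun n : ℕ => G n / (n : ℝ) ^ r) : Tendsto G atTop (𝓝 0) := by
  have hl0 : 0 ≤ l := ge_of_tendsto' hG hG0
  rcases hl0.eq_or_lt with rfl | hl
  · exact hG
  · exfalso
    have hev : ∀ᶠ n in atTop, l / 2 ≤ G n := hG.eventually_const_le (by linarith)
    have h1 : Summable fun n : ℕ => (l / 2) * ((n : ℝ) ^ r)⁻¹ := by
      refine Summable.of_norm_bounded_eventually_nat hs ?_
      filter_upwards [hev] with n hn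
      have := Real.rpow_nonneg (n.cast_nonneg : (0 : ℝ) ≤ n) r
      rw [Real.norm_of_nonneg (by positivity), div_eq_mul_inv (G n)]
      gcongr
    have h2 := (summable_mul_left_iff (by positivity : l / 2 ≠ 0)).1 h1
    linarith [Real.summable_nat_rpow_inv.1 h2, hr.2]

end PowerWeights

/-! ### Reduction of Ravine to Nesterov iterates, and their filtration. -/

section Iterates

variable {Ω H : Type*}

/-- The gradient-descent iterates `x₀ = y₀`, `x_{n+1} = w_n` underlying the Ravine method. -/
def sragIter (y w : ℕ → Ω → H) : ℕ → Ω → H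
  | 0 => y 0
  | n + 1 => w n

theorem measurable_sragIter_sragSigma [MeasurableSpace H] (y w : ℕ → Ω → H) {j k : ℕ}
    (hjk : j ≤ k) : Measurable[sragSigma y w k] (sragIter y w j) := by
  cases j with
  | zero => exact (comap_measurable (y 0)).mono le_sup_left le_rfl
  | succ n =>
    refine (comap_measurable (w n)).mono (le_trans ?_ le_sup_right) le_rfl
    exact le_iSup₂_of_le (f := fun i (_ : i ∈ Set.Iio k) =>
      MeasurableSpace.comap (w i) inferInstance) n hjk le_rfl

theorem sragSigma_mono [MeasurableSpace H] (y w : ℕ → Ω → H) : Monotone (sragSigma y w) :=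
  fun _ _ hij => sup_le_sup_left
    (biSup_mono fun _ hn => lt_of_lt_of_le hn hij) _

variable [NormedAddCommGroup H] [InnerProductSpace ℝ H] [CompleteSpace H] {f : H → ℝ}
  {s a : ℕ → ℝ} {e y w : ℕ → Ω → H}

theorem IsSRAG.y_succ (h : IsSRAG f s a e y w) (n : ℕ) (ω : Ω) :
    y (n + 1) ω = sragIter y w (n + 1) ω
      + a (n + 1) • (sragIter y w (n + 1) ω - sragIter y w n ω) := by
  cases n with
  | zero => exact h.y_one ω
  | succ n => exact h.y_add_two n ω

theorem IsSRAG.iter_succ (h : IsSRAG f s a e y w) (n : ℕ) (ω : Ω) :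
    sragIter y w (n + 1) ω = y n ω - s n • (∇ f (y n ω) + e n ω) :=
  h.w_eq n ω

variable [MeasurableSpace H] [BorelSpace H] [SecondCountableTopology H]

theorem IsSRAG.measurable_y_sragSigma (h : IsSRAG f s a e y w) (n : ℕ) :
    Measurable[sragSigma y w (n + 1)] (y (n + 1)) := by
  have h1 := measurable_sragIter_sragSigma y w (le_refl (n + 1))
  have h2 := measurable_sragIter_sragSigma y w n.le_succ
  have : y (n + 1) = fun ω => sragIter y w (n + 1) ω
      + a (n + 1) • (sragIter y w (n + 1) ω - sragIter y w n ω) := funext (h.y_succ n)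
  rw [this]
  exact h1.add ((h1.sub h2).const_smul _)

variable [m0 : MeasurableSpace Ω]

theorem IsSRAG.measurable_iter (h : IsSRAG f s a e y w) (hg : Continuous (∇ f))
    (he : ∀ k, Measurable (e k)) (hy0 : Measurable (y 0)) (n : ℕ) :
    Measurable (sragIter y w n) ∧ Measurable (y n) := by
  induction n with
  | zero => exact ⟨hy0, hy0⟩
  | succ n ih =>
    have h1 : Measurable (sragIter y w (n + 1)) := by
      rw [show sragIter y w (n + 1) = fun ω => y n ω - s n • (∇ f (y n ω) + e n ω) from
        funext (h.iter_succ n)]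
      exact ih.2.sub (((hg.measurable.comp ih.2).add (he n)).const_smul _)
    refine ⟨h1, ?_⟩
    rw [show y (n + 1) = fun ω => sragIter y w (n + 1) ω
      + a (n + 1) • (sragIter y w (n + 1) ω - sragIter y w n ω) from funext (h.y_succ n)]
    exact h1.add ((h1.sub ih.1).const_smul _)

/-- The canonical filtration of the iterates, started at index `1`. -/
def IsSRAG.filtration (h : IsSRAG f s a e y w) (hg : Continuous (∇ f))
    (he : ∀ k, Measurable (e k)) (hy0 : Measurable (y 0)) : Filtration ℕ m0 where
  seq n := sragSigma y w (n + 1)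
  mono' _ _ hij := sragSigma_mono y w (Nat.add_le_add_right hij 1)
  le' _ := sup_le hy0.comap_le
    (iSup₂_le fun i _ => (h.measurable_iter hg he hy0 (i + 1)).1.comap_le)

end Iterates

/-! ### Almost sure behaviour of the two energies. -/

section EnergyAsymptotics

variable {Ω H : Type*} [NormedAddCommGroup H] [InnerProductSpace ℝ H]
  [MeasurableSpace H] [BorelSpace H] [SecondCountableTopology H]

theorem Summable.sq_of_nonneg {u : ℕ → ℝ} (hu0 : ∀ n, 0 ≤ u n) (hu : Summable u) :
    Summable fun n => u n ^ 2 := by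
  refine Summable.of_norm_bounded_eventually_nat hu ?_
  filter_upwards [hu.tendsto_atTop_zero.eventually_le_const one_pos] with n hn
  rw [Real.norm_of_nonneg (sq_nonneg _)]
  nlinarith [hu0 n]

theorem measurable_inertialEnergy {f : H → ℝ} (hf : Continuous f) {m : MeasurableSpace Ω}
    (l p s : ℝ) (z : H) {x₀ x₁ : Ω → H} (h0 : Measurable x₀) (h1 : Measurable x₁) :
    Measurable fun ω => inertialEnergy f l p s z (x₀ ω) (x₁ ω) := by
  have hf1 : Measurable fun ω => f (x₁ ω) := hf.measurable.comp h1
  unfold inertialEnergy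
  fun_prop

variable [CompleteSpace H]

theorem measurable_inertialNoiseCoeff {f : H → ℝ} (hg : Continuous (∇ f)) {m : MeasurableSpace Ω}
    (l p s : ℝ) (z : H) {x y : Ω → H} (h0 : Measurable x) (h1 : Measurable y) :
    Measurable fun ω => inertialNoiseCoeff f l p s z (x ω) (y ω) := by
  have hg1 : Measurable fun ω => ∇ f (y ω) := hg.measurable.comp h1
  have hg2 : Measurable fun ω => ∇ f (y ω - s • ∇ f (y ω)) :=
    hg.measurable.comp (h1.sub (hg1.const_smul s))
  unfold inertialNoiseCoeff
  fun_prop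

theorem measurable_inertialDecrease {f : H → ℝ} (hf : Continuous f) (hg : Continuous (∇ f))
    {m : MeasurableSpace Ω} (L l p p' s₀ s : ℝ) (z : H) {x₀ x₁ y x₂ : Ω → H} (h0 : Measurable x₀)
    (h1 : Measurable x₁) (hy : Measurable y) (h2 : Measurable x₂) :
    Measurable fun ω => inertialDecrease f L l p p' s₀ s z (x₀ ω) (x₁ ω) (y ω) (x₂ ω) := by
  have hf1 : Measurable fun ω => f (x₁ ω) := hf.measurable.comp h1
  have hg1 : Measurable fun ω => ∇ f (y ω) := hg.measurable.comp hy
  have hg2 : Measurable fun ω => ∇ f (x₁ ω) := hg.measurable.comp h1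
  have hg3 : Measurable fun ω => ∇ f (x₂ ω) := hg.measurable.comp h2
  unfold inertialDecrease
  fun_prop

/-- Along almost every trajectory the two energies converge and the energy decreases are
summable. -/
theorem IsSRAG.ae_energy_asymptotics [MeasurableSpace Ω] {P : Measure Ω} [IsProbabilityMeasure P]
    {f : H → ℝ} (hconv : ConvexOn ℝ Set.univ f) (hdiff : Differentiable ℝ f)
    {L : ℝ≥0} (hL : 0 < L) (hlip : LipschitzWith L (∇ f)) {z : H} (hz : IsMinOn f Set.univ z)
    {s : ℕ → ℝ} (hs : ∀ k, s k ∈ Set.Ioc (0 : ℝ) (1 / (L : ℝ))) (hs_anti : Antitone s)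
    {α r : ℝ} (hα : 0 < α) (hr : r ∈ Set.Ioo (0 : ℝ) 1)
    {e y w : ℕ → Ω → H} (he : ∀ k, Measurable (e k)) (hy0 : Measurable (y 0))
    (hsrag : IsSRAG f s (fun k => 1 - α / (k : ℝ) ^ r) e y w)
    (he_int : ∀ k, Integrable (e k) P) (he_zero : ∀ k, P[e k | sragSigma y w k] =ᵐ[P] 0)
    (hσ_fin : ∀ k, ∀ᵐ ω ∂P, noiseVar P (sragSigma y w) e k ω < ∞)
    (hσ_sum : ∀ᵐ ω ∂P, Summable fun k : ℕ =>
      (k : ℝ) ^ r * s k * noiseStd P (sragSigma y w) e k ω) :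
    ∀ᵐ ω ∂P,
      (∃ l, Tendsto (fun n : ℕ => inertialEnergy f (α / 2) ((n : ℝ) ^ r) (s n) z
        (sragIter y w n ω) (sragIter y w (n + 1) ω)) atTop (𝓝 l)) ∧
      (Summable fun n : ℕ => inertialDecrease f L (α / 2) ((n : ℝ) ^ r) (((n + 1 : ℕ) : ℝ) ^ r)
        (s n) (s (n + 1)) z (sragIter y w n ω) (sragIter y w (n + 1) ω) (y (n + 1) ω)
        (sragIter y w (n + 2) ω)) ∧
      (∃ l, Tendsto (fun n : ℕ => inertialEnergy f 0 ((n : ℝ) ^ r) (s n) z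
        (sragIter y w n ω) (sragIter y w (n + 1) ω)) atTop (𝓝 l)) := by
  have hg : Continuous (∇ f) := hlip.continuous
  have hf : Continuous f := hdiff.continuous
  have hl : 0 < α / 2 := half_pos hα
  have hF : ∀ x, 0 ≤ f x - f z := fun x => sub_nonneg.2 (hz (Set.mem_univ _))
  let ℱ := hsrag.filtration hg he hy0
  set x := sragIter y w with hx
  -- `ℱ k` is the canonical σ-algebra of index k + 1: it already knows x_{k+1} and y_{k+1}, and
  -- e_{k+1} is centred given it.
  have hxm : ∀ j k, j ≤ k + 1 → Measurable[ℱ k] (x j) := fun j k hjk =>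
    measurable_sragIter_sragSigma y w hjk
  have hym : ∀ k, Measurable[ℱ k] (y (k + 1)) := fun k => hsrag.measurable_y_sragSigma k
  have hy : ∀ n ω, y (n + 1) ω
      = x (n + 1) ω + (1 - α / ((n + 1 : ℕ) : ℝ) ^ r) • (x (n + 1) ω - x n ω) :=
    fun n ω => hsrag.y_succ n ω
  have hx2 : ∀ n ω, x (n + 2) ω
      = y (n + 1) ω - s (n + 1) • (∇ f (y (n + 1) ω) + e (n + 1) ω) :=
    fun n ω => hsrag.iter_succ (n + 1) ω
  -- The thresholds of the one-step inequality for l = α/2; increments of n^r tend to 0 because r <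
  -- 1.
  obtain ⟨N, hN⟩ : ∃ N : ℕ, ∀ n : ℕ, N ≤ n → 1 ≤ n ∧
      ((n + 1 : ℕ) : ℝ) ^ r - (n : ℝ) ^ r ≤ α / 2 / 4 ∧ 4 * (α / 2) ≤ (n : ℝ) ^ r := by
    obtain ⟨N, hN⟩ := eventually_atTop.1 ((eventually_ge_atTop 1).and
      ((eventually_natCast_rpow_succ_sub_le hr (show 0 < α / 2 / 4 by linarith)).and
        ((tendsto_natCast_rpow_atTop hr).eventually_ge_atTop (4 * (α / 2)))))
    exact ⟨N, hN⟩
  have hpa : ∀ n : ℕ, ((n + 1 : ℕ) : ℝ) ^ r * (1 - α / ((n + 1 : ℕ) : ℝ) ^ r)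
      = ((n + 1 : ℕ) : ℝ) ^ r - α := fun n => by
    have : (0 : ℝ) < ((n + 1 : ℕ) : ℝ) ^ r := Real.rpow_pos_of_pos (by positivity) r
    field_simp
  -- These terms are twice the squares of the summable sequence k^r s_k σ_k, shifted by one.
  have hqs : ∀ᵐ ω ∂P, Summable fun k : ℕ => 2 * ((((k + 1 : ℕ) : ℝ) ^ r) ^ 2 * s (k + 1) ^ 2) *
      (condLExp (ℱ k) P (fun ω => ‖e (k + 1) ω‖ₑ ^ 2) ω).toReal := by
    filter_upwards [hσ_sum] with ω hω
    have h1 := Summable.sq_of_nonneg (fun k => by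
      have := (hs k).1.le
      have : 0 ≤ noiseStd P (sragSigma y w) e k ω := Real.sqrt_nonneg _
      positivity) hω
    have h2 := ((summable_nat_add_iff 1).2 h1).mul_left 2
    refine h2.congr fun k => ?_
    rw [mul_pow, mul_pow, noiseStd, Real.sq_sqrt ENNReal.toReal_nonneg, ← mul_assoc]
    rfl
  have hs0 : ∀ n, 0 < s n := fun n => (hs n).1
  have hdec0 : ∀ n, N ≤ n → ∀ ω, min 1 (α / 2 / 2) * (n : ℝ) ^ r * s n * (f (x (n + 1) ω) - f z)
      ≤ inertialDecrease f L (α / 2) ((n : ℝ) ^ r) (((n + 1 : ℕ) : ℝ) ^ r)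
        (s n) (s (n + 1)) z (x n ω) (x (n + 1) ω) (y (n + 1) ω) (x (n + 2) ω) := by
    intro n hn ω
    obtain ⟨h1, h2, h3⟩ := hN n hn
    have h4 := natCast_rpow_le_succ hr n
    have h5 := hs0 (n + 1)
    have h6 := one_le_natCast_rpow hr h1
    unfold inertialDecrease
    have i1 : 0 ≤ (((n + 1 : ℕ) : ℝ) ^ r) ^ 2 * s (n + 1) ^ 2 / 4 * ‖∇ f (x (n + 2) ω)‖ ^ 2 := by
      positivity
    have i2 : 0 ≤ ((n + 1 : ℕ) : ℝ) ^ r * (((n + 1 : ℕ) : ℝ) ^ r - α / 2) * s (n + 1) / (2 * L)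
        * ‖∇ f (y (n + 1) ω) - ∇ f (x (n + 1) ω)‖ ^ 2 := by
      have : 0 ≤ ((n + 1 : ℕ) : ℝ) ^ r - α / 2 := by linarith
      positivity
    have i3 : 0 ≤ α / 2 / 4 * (n : ℝ) ^ r * ‖x (n + 1) ω - x n ω‖ ^ 2 := by positivity
    linarith
  have stage1 := robbins_siegmund_noisy (P := P) ℱ N
    (V := fun n ω => inertialEnergy f (α / 2) ((n : ℝ) ^ r) (s n) z (x n ω) (x (n + 1) ω))
    (b := fun _ _ => 0)
    (c := fun n ω => inertialDecrease f L (α / 2) ((n : ℝ) ^ r) (((n + 1 : ℕ) : ℝ) ^ r)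
        (s n) (s (n + 1)) z (x n ω) (x (n + 1) ω) (y (n + 1) ω) (x (n + 2) ω))
    (fun n => measurable_inertialEnergy (m := ℱ n) hf _ _ _ _ (hxm _ _ n.le_succ)
      (hxm _ _ le_rfl))
    (fun _ => measurable_const)
    (fun n => measurable_inertialDecrease (m := ℱ (n + 1)) hf hg _ _ _ _ _ _ _
      (hxm _ _ (by omega)) (hxm _ _ (by omega))
      ((hym n).mono (ℱ.mono n.le_succ) le_rfl) (hxm _ _ le_rfl))
    (fun n ω => inertialEnergy_nonneg hz _ _ (hs0 n).le _ _)
    (fun _ _ => le_rfl)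
    (fun n hn ω => le_trans (by
      have := hs0 n
      have := hF (x (n + 1) ω)
      positivity) (hdec0 n hn ω))
    (a := fun n => 2 / (α / 2) * ((((n + 1 : ℕ) : ℝ) ^ r - (n : ℝ) ^ r) ^ 2 / (n : ℝ) ^ r))
    (fun n => by positivity)
    ((summable_natCast_rpow_sub_sq_div hr).mul_left _)
    (ζ := fun n ω => inertialNoiseCoeff f (α / 2) (((n + 1 : ℕ) : ℝ) ^ r) (s (n + 1)) z
      (x (n + 1) ω) (y (n + 1) ω))
    (e := fun n => e (n + 1))
    (fun n => (measurable_inertialNoiseCoeff (m := ℱ n) hg _ _ _ _ (hxm _ _ le_rfl)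
      (hym n)).stronglyMeasurable)
    (fun n => he_int (n + 1)) (fun n => he_zero (n + 1)) (fun n => hσ_fin (n + 1))
    (q := fun n => 2 * ((((n + 1 : ℕ) : ℝ) ^ r) ^ 2 * s (n + 1) ^ 2))
    (fun n => by positivity)
    (ae_of_all _ fun _ => summable_zero) hqs
    (fun n hn ω => by
      obtain ⟨h1, h2, h3⟩ := hN n hn
      have := inertialEnergy_add_decrease_le hconv hdiff hL hlip hz (hs0 (n + 1))
        (hs_anti n.le_succ) (hs (n + 1)).2 hl (natCast_rpow_le_succ hr n) h2
        (one_le_natCast_rpow hr h1) h3 ((hpa n).trans (by ring)) (hy n ω) (e (n + 1) ω)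
      rw [← hx2 n ω] at this
      linarith)
  -- The perturbation `b` of the unanchored energy is summable because the first stage has summed
  -- the decrease, which dominates it.
  have stage2 := robbins_siegmund_noisy (P := P) ℱ N
    (V := fun n ω => inertialEnergy f 0 ((n : ℝ) ^ r) (s n) z (x n ω) (x (n + 1) ω))
    (b := fun n ω => 4 * ((n : ℝ) ^ r * s n * (f (x (n + 1) ω) - f z)))
    (c := fun _ _ => 0)
    (fun n => measurable_inertialEnergy (m := ℱ n) hf _ _ _ _ (hxm _ _ n.le_succ)
      (hxm _ _ le_rfl))
    (fun n => (((hf.measurable.comp (hxm (n + 1) n le_rfl)).sub_const _).const_mul _).const_mul _)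
    (fun _ => measurable_const)
    (fun n ω => inertialEnergy_nonneg hz _ _ (hs0 n).le _ _)
    (fun n ω => by
      have := hs0 n
      have := hF (x (n + 1) ω)
      positivity)
    (fun _ _ _ => le_rfl)
    (a := fun _ => 0) (fun _ => le_rfl) summable_zero
    (ζ := fun n ω => inertialNoiseCoeff f 0 (((n + 1 : ℕ) : ℝ) ^ r) (s (n + 1)) z
      (x (n + 1) ω) (y (n + 1) ω))
    (e := fun n => e (n + 1))
    (fun n => (measurable_inertialNoiseCoeff (m := ℱ n) hg _ _ _ _ (hxm _ _ le_rfl)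
      (hym n)).stronglyMeasurable)
    (fun n => he_int (n + 1)) (fun n => he_zero (n + 1)) (fun n => hσ_fin (n + 1))
    (q := fun n => 2 * ((((n + 1 : ℕ) : ℝ) ^ r) ^ 2 * s (n + 1) ^ 2))
    (fun n => by positivity) (by
      filter_upwards [stage1] with ω hω
      have hκ : 0 < min 1 (α / 2 / 2) := lt_min one_pos (by linarith)
      refine Summable.mul_left _ ?_
      refine (summable_mul_left_iff hκ.ne').1 (Summable.of_norm_bounded_eventually_nat hω.2 ?_)
      filter_upwards [eventually_ge_atTop N] with n hn
      have := hs0 n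
      have := hF (x (n + 1) ω)
      rw [Real.norm_of_nonneg (by positivity), ← mul_assoc, ← mul_assoc]
      exact hdec0 n hn ω) hqs
    (fun n hn ω => by
      obtain ⟨h1, h2, h3⟩ := hN n hn
      have := inertialEnergy_zero_le hconv hdiff hL hlip hz (hs0 (n + 1))
        (hs_anti n.le_succ) (hs (n + 1)).2 hα.le (natCast_rpow_le_succ hr n) (by linarith)
        ((natCast_rpow_succ_sub_le hr h1).trans (natCast_rpow_sub_one_le_one hr h1))
        (one_le_natCast_rpow hr h1) (by linarith) (hpa n) (hy n ω) (e (n + 1) ω)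
      rw [← hx2 n ω] at this
      linarith)
  filter_upwards [stage1, stage2] with ω h1 h2
  exact ⟨h1.1, h1.2, h2.1⟩

end EnergyAsymptotics

/-! ### Deterministic consequences along one trajectory. -/

section Rates

variable {H : Type*} [NormedAddCommGroup H] [InnerProductSpace ℝ H] [CompleteSpace H]
  {f : H → ℝ} {L : ℝ≥0} {z : H} {s : ℕ → ℝ} {α r : ℝ} {x y : ℕ → H}

/-- The pathwise estimates on a trajectory from which the convergence rates follow. -/
structure InertialEstimates (f : H → ℝ) (L : ℝ≥0) (z : H) (s : ℕ → ℝ) (α r : ℝ) (x y : ℕ → H) :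
    Prop where
  y_succ : ∀ n, y (n + 1) = x (n + 1) + (1 - α / ((n + 1 : ℕ) : ℝ) ^ r) • (x (n + 1) - x n)
  energy : ∃ l, Tendsto (fun n : ℕ => inertialEnergy f (α / 2) ((n : ℝ) ^ r) (s n) z
    (x n) (x (n + 1))) atTop (𝓝 l)
  decrease : Summable fun n : ℕ => inertialDecrease f L (α / 2) ((n : ℝ) ^ r)
    (((n + 1 : ℕ) : ℝ) ^ r) (s n) (s (n + 1)) z (x n) (x (n + 1)) (y (n + 1)) (x (n + 2))
  energy_zero : ∃ l, Tendsto (fun n : ℕ => inertialEnergy f 0 ((n : ℝ) ^ r) (s n) z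
    (x n) (x (n + 1))) atTop (𝓝 l)

theorem InertialEstimates.summable_components (h : InertialEstimates f L z s α r x y)
    (hz : IsMinOn f Set.univ z) (hs : ∀ k, 0 < s k) (hα : 0 < α) (hr : r ∈ Set.Ioo (0 : ℝ) 1) :
    (Summable fun n : ℕ => (((n + 1 : ℕ) : ℝ) ^ r) ^ 2 * s (n + 1) ^ 2 / 4
      * ‖∇ f (x (n + 2))‖ ^ 2) ∧
    (Summable fun n : ℕ => ((n + 1 : ℕ) : ℝ) ^ r * (((n + 1 : ℕ) : ℝ) ^ r - α / 2) * s (n + 1)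
      / (2 * L) * ‖∇ f (y (n + 1)) - ∇ f (x (n + 1))‖ ^ 2) ∧
    (Summable fun n : ℕ => (n : ℝ) ^ r * ‖x (n + 1) - x n‖ ^ 2) ∧
    (Summable fun n : ℕ => (n : ℝ) ^ r * s n * (f (x (n + 1)) - f z)) := by
  have hF : ∀ x, 0 ≤ f x - f z := fun x => sub_nonneg.2 (hz (Set.mem_univ _))
  have hκ : 0 < min 1 (α / 2 / 2) := lt_min one_pos (by linarith)
  have hev : ∀ᶠ n : ℕ in atTop, α / 2 ≤ ((n + 1 : ℕ) : ℝ) ^ r :=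
    (tendsto_add_atTop_iff_nat 1).2 (tendsto_natCast_rpow_atTop hr) |>.eventually_ge_atTop (α / 2)
  have key : ∀ᶠ n : ℕ in atTop,
      0 ≤ (((n + 1 : ℕ) : ℝ) ^ r) ^ 2 * s (n + 1) ^ 2 / 4 * ‖∇ f (x (n + 2))‖ ^ 2 ∧
      0 ≤ ((n + 1 : ℕ) : ℝ) ^ r * (((n + 1 : ℕ) : ℝ) ^ r - α / 2) * s (n + 1)
        / (2 * L) * ‖∇ f (y (n + 1)) - ∇ f (x (n + 1))‖ ^ 2 ∧
      0 ≤ α / 2 / 4 * (n : ℝ) ^ r * ‖x (n + 1) - x n‖ ^ 2 ∧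
      0 ≤ min 1 (α / 2 / 2) * (n : ℝ) ^ r * s n * (f (x (n + 1)) - f z) := by
    filter_upwards [hev] with n hn
    have h1 := hs n
    have h2 := hs (n + 1)
    have h3 := hF (x (n + 1))
    have h4 : 0 ≤ ((n + 1 : ℕ) : ℝ) ^ r - α / 2 := by linarith
    refine ⟨by positivity, by positivity, by positivity, by positivity⟩
  refine ⟨?_, ?_, ?_, ?_⟩
  · refine Summable.of_norm_bounded_eventually_nat h.decrease ?_
    filter_upwards [key] with n ⟨h1, h2, h3, h4⟩
    rw [Real.norm_of_nonneg h1]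
    unfold inertialDecrease
    linarith
  · refine Summable.of_norm_bounded_eventually_nat h.decrease ?_
    filter_upwards [key] with n ⟨h1, h2, h3, h4⟩
    rw [Real.norm_of_nonneg h2]
    unfold inertialDecrease
    linarith
  · refine (summable_mul_left_iff (show α / 2 / 4 ≠ 0 by positivity)).1
      (Summable.of_norm_bounded_eventually_nat h.decrease ?_)
    filter_upwards [key] with n ⟨h1, h2, h3, h4⟩
    rw [← mul_assoc, Real.norm_of_nonneg h3]
    unfold inertialDecrease
    linarith
  · refine (summable_mul_left_iff hκ.ne').1
      (Summable.of_norm_bounded_eventually_nat h.decrease ?_)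
    filter_upwards [key] with n ⟨h1, h2, h3, h4⟩
    rw [← mul_assoc, ← mul_assoc, Real.norm_of_nonneg h4]
    unfold inertialDecrease
    linarith

/-- Divided by n^r, this energy is exactly a combination of two of the summable components, so its
limit can only be 0. -/
theorem InertialEstimates.energy_zero_tendsto (h : InertialEstimates f L z s α r x y)
    (hz : IsMinOn f Set.univ z) (hs : ∀ k, 0 < s k) (hα : 0 < α) (hr : r ∈ Set.Ioo (0 : ℝ) 1) :
    Tendsto (fun n : ℕ => inertialEnergy f 0 ((n : ℝ) ^ r) (s n) z (x n) (x (n + 1)))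
      atTop (𝓝 0) := by
  obtain ⟨-, -, h3, h4⟩ := h.summable_components hz hs hα hr
  obtain ⟨l, hl⟩ := h.energy_zero
  refine tendsto_zero_of_summable_div_rpow hr (fun n => inertialEnergy_nonneg hz _ _ (hs n).le _ _)
    hl ((h4.add (h3.mul_left (1 / 2))).congr fun n => ?_)
  unfold inertialEnergy
  rw [zero_smul, zero_add, norm_smul, Real.norm_eq_abs, mul_pow, sq_abs]
  rcases eq_or_ne ((n : ℝ) ^ r) 0 with h0 | h0
  · simp [h0]
  · field_simp
    ring

theorem InertialEstimates.tendsto_velocity (h : InertialEstimates f L z s α r x y)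
    (hz : IsMinOn f Set.univ z) (hs : ∀ k, 0 < s k) (hα : 0 < α) (hr : r ∈ Set.Ioo (0 : ℝ) 1) :
    Tendsto (fun n : ℕ => (n : ℝ) ^ r * ‖x (n + 1) - x n‖) atTop (𝓝 0) := by
  have h0 := (h.energy_zero_tendsto hz hs hα hr).const_mul 2
  have h1 := h0.sqrt
  rw [mul_zero, Real.sqrt_zero] at h1
  refine squeeze_zero (fun n => by positivity) (fun n => ?_) h1
  refine Real.le_sqrt_of_sq_le ?_
  have hF : 0 ≤ f (x (n + 1)) - f z := sub_nonneg.2 (hz (Set.mem_univ _))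
  have := hs n
  have : 0 ≤ s n * ((n : ℝ) ^ r) ^ 2 * (f (x (n + 1)) - f z) := by positivity
  unfold inertialEnergy
  rw [zero_smul, zero_add, norm_smul, Real.norm_eq_abs, mul_pow, mul_pow, sq_abs]
  linarith

theorem InertialEstimates.tendsto_gap (h : InertialEstimates f L z s α r x y)
    (hz : IsMinOn f Set.univ z) (hs : ∀ k, 0 < s k) (hα : 0 < α) (hr : r ∈ Set.Ioo (0 : ℝ) 1) :
    Tendsto (fun n : ℕ => s n * ((n : ℝ) ^ r) ^ 2 * (f (x (n + 1)) - f z)) atTop (𝓝 0) := by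
  refine squeeze_zero (fun n => ?_) (fun n => ?_) (h.energy_zero_tendsto hz hs hα hr)
  · have hF : 0 ≤ f (x (n + 1)) - f z := sub_nonneg.2 (hz (Set.mem_univ _))
    have := hs n
    positivity
  · unfold inertialEnergy
    have : 0 ≤ 1 / 2 * ‖(0 : ℝ) • (x n - z) + ((n : ℝ) ^ r) • (x (n + 1) - x n)‖ ^ 2 := by
      positivity
    linarith

theorem eventually_abs_extrapolation_le_one (hα : 0 < α) (hr : r ∈ Set.Ioo (0 : ℝ) 1) :
    ∀ᶠ n : ℕ in atTop, |1 - α / ((n + 1 : ℕ) : ℝ) ^ r| ≤ 1 := by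
  filter_upwards [(tendsto_add_atTop_iff_nat 1).2 (tendsto_natCast_rpow_atTop hr)
    |>.eventually_ge_atTop α] with n hn
  have hp : (0 : ℝ) < ((n + 1 : ℕ) : ℝ) ^ r := Real.rpow_pos_of_pos (by positivity) r
  have h1 : α / ((n + 1 : ℕ) : ℝ) ^ r ≤ 1 := (div_le_one hp).2 hn
  have h2 : 0 < α / ((n + 1 : ℕ) : ℝ) ^ r := by positivity
  rw [abs_le]
  constructor <;> linarith

theorem InertialEstimates.eventually_norm_sub_le (h : InertialEstimates f L z s α r x y)
    (hα : 0 < α) (hr : r ∈ Set.Ioo (0 : ℝ) 1) :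
    ∀ᶠ n : ℕ in atTop, ‖y (n + 1) - x (n + 1)‖ ≤ ‖x (n + 1) - x n‖ := by
  filter_upwards [eventually_abs_extrapolation_le_one hα hr] with n hn
  rw [h.y_succ, add_sub_cancel_left, norm_smul, Real.norm_eq_abs]
  exact mul_le_of_le_one_left (norm_nonneg _) hn

theorem InertialEstimates.eventually_norm_increment_le (h : InertialEstimates f L z s α r x y)
    (hα : 0 < α) (hr : r ∈ Set.Ioo (0 : ℝ) 1) :
    ∀ᶠ n : ℕ in atTop, ‖y (n + 2) - y (n + 1)‖
      ≤ 2 * ‖x (n + 2) - x (n + 1)‖ + ‖x (n + 1) - x n‖ := by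
  have h1 := h.eventually_norm_sub_le hα hr
  have h2 := (tendsto_add_atTop_nat 1).eventually h1
  filter_upwards [h1, h2] with n h1 h2
  have e : y (n + 2) - y (n + 1) = (y (n + 2) - x (n + 2)) + (x (n + 2) - x (n + 1))
      - (y (n + 1) - x (n + 1)) := by abel
  rw [e]
  have := norm_sub_le ((y (n + 2) - x (n + 2)) + (x (n + 2) - x (n + 1))) (y (n + 1) - x (n + 1))
  have := norm_add_le (y (n + 2) - x (n + 2)) (x (n + 2) - x (n + 1))
  linarith

theorem InertialEstimates.isLittleO_gap (h : InertialEstimates f L z s α r x y)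
    (hconv : ConvexOn ℝ Set.univ f) (hdiff : Differentiable ℝ f)
    (hL : 0 < L) (hlip : LipschitzWith L (∇ f)) (hz : IsMinOn f Set.univ z)
    (hs : ∀ k, s k ∈ Set.Ioc (0 : ℝ) (1 / (L : ℝ))) (hs_anti : Antitone s)
    (hα : 0 < α) (hr : r ∈ Set.Ioo (0 : ℝ) 1) :
    (fun k => f (y k) - f z) =o[atTop] fun k : ℕ => 1 / (s k * (k : ℝ) ^ (2 * r)) := by
  have hs0 : ∀ n, 0 < s n := fun n => (hs n).1
  have hF : ∀ x, 0 ≤ f x - f z := fun x => sub_nonneg.2 (hz (Set.mem_univ _))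
  have hL' : (0 : ℝ) < L := hL
  refine isLittleO_of_tendsto' ?_ ?_
  · filter_upwards [eventually_ge_atTop 1] with k hk h0
    exfalso
    have hk0 : (0 : ℝ) < k := by exact_mod_cast hk
    have := hs0 k
    have : 0 < 1 / (s k * (k : ℝ) ^ (2 * r)) := by positivity
    linarith
  · rw [← tendsto_add_atTop_iff_nat 1]
    -- The factor 8 is 4 from replacing (n+1)^{2r} by n^{2r}, times 2 from comparing the gap at y
    -- with the gap at x.
    have hG := (h.energy_zero_tendsto hz hs0 hα hr).const_mul 8
    rw [mul_zero] at hG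
    refine squeeze_zero' (Eventually.of_forall fun n => ?_) ?_ hG
    · have := hs0 (n + 1)
      have := hF (y (n + 1))
      positivity
    · filter_upwards [h.eventually_norm_sub_le hα hr, eventually_ge_atTop 1] with n h1 h2
      have hp2 : ((n + 1 : ℕ) : ℝ) ^ (2 * r) = (((n + 1 : ℕ) : ℝ) ^ r) ^ 2 := by
        rw [mul_comm, Real.rpow_mul (by positivity), Real.rpow_ofNat]
      rw [hp2, div_div_eq_mul_div, div_one]
      have h3 := natCast_rpow_succ_le_two_mul hr h2
      have h4 := sub_min_le_two_mul_add_sq hconv hdiff hL hlip hz (x (n + 1)) (y (n + 1))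
      have h5 := one_le_natCast_rpow hr h2
      have h6 : s (n + 1) * L ≤ 1 := by
        have := (hs (n + 1)).2
        rwa [le_div_iff₀ hL'] at this
      have h7 : (((n + 1 : ℕ) : ℝ) ^ r) ^ 2 ≤ 4 * ((n : ℝ) ^ r) ^ 2 := by
        have := pow_le_pow_left₀ (by positivity) h3 2
        linarith
      have h8 := hs0 (n + 1)
      have h9 := hF (x (n + 1))
      have h10 : s (n + 1) * (((n + 1 : ℕ) : ℝ) ^ r) ^ 2 ≤ s n * (4 * ((n : ℝ) ^ r) ^ 2) :=
        mul_le_mul (hs_anti n.le_succ) h7 (by positivity) (hs0 n).le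
      have h11 : ‖y (n + 1) - x (n + 1)‖ ^ 2 ≤ ‖x (n + 1) - x n‖ ^ 2 :=
        pow_le_pow_left₀ (norm_nonneg _) h1 2
      have h12 : (s (n + 1) * L) * ((((n + 1 : ℕ) : ℝ) ^ r) ^ 2 * ‖y (n + 1) - x (n + 1)‖ ^ 2)
          ≤ 1 * (4 * ((n : ℝ) ^ r) ^ 2 * ‖x (n + 1) - x n‖ ^ 2) :=
        mul_le_mul h6 (mul_le_mul h7 h11 (by positivity) (by positivity)) (by positivity) one_pos.le
      have h13 := mul_le_mul_of_nonneg_right h10 h9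
      have h14 := mul_le_mul_of_nonneg_right h4
        (show 0 ≤ s (n + 1) * (((n + 1 : ℕ) : ℝ) ^ r) ^ 2 by positivity)
      unfold inertialEnergy
      rw [zero_smul, zero_add, norm_smul, Real.norm_eq_abs, mul_pow, sq_abs]
      linarith

theorem InertialEstimates.isLittleO_increment (h : InertialEstimates f L z s α r x y)
    (hz : IsMinOn f Set.univ z) (hs : ∀ k, 0 < s k) (hα : 0 < α) (hr : r ∈ Set.Ioo (0 : ℝ) 1) :
    (fun k => ‖y (k + 1) - y k‖) =o[atTop] fun k : ℕ => 1 / ((k + 1 : ℕ) : ℝ) ^ r := by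
  refine isLittleO_of_tendsto (fun k h0 => ?_) ?_
  · exfalso
    have : 0 < 1 / ((k + 1 : ℕ) : ℝ) ^ r := by positivity
    linarith
  · rw [← tendsto_add_atTop_iff_nat 1]
    have hv := h.tendsto_velocity hz hs hα hr
    have hv1 := (tendsto_add_atTop_iff_nat 1).2 hv
    have hv2 := (hv1.const_mul 4).add (hv.const_mul 4)
    rw [mul_zero, add_zero] at hv2
    refine squeeze_zero' (Eventually.of_forall fun n => by positivity) ?_ hv2
    filter_upwards [h.eventually_norm_increment_le hα hr, eventually_ge_atTop 1] with n h1 h2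
    rw [div_div_eq_mul_div, div_one]
    have h3 := natCast_rpow_succ_le_two_mul hr h2
    have h4 := natCast_rpow_succ_le_two_mul hr (show 1 ≤ n + 1 by omega)
    have h5 : ‖y (n + 1 + 1) - y (n + 1)‖ * ((n + 1 + 1 : ℕ) : ℝ) ^ r
        ≤ (2 * ‖x (n + 2) - x (n + 1)‖ + ‖x (n + 1) - x n‖) * ((n + 1 + 1 : ℕ) : ℝ) ^ r :=
      mul_le_mul_of_nonneg_right h1 (by positivity)
    have h6 : ‖x (n + 2) - x (n + 1)‖ * ((n + 1 + 1 : ℕ) : ℝ) ^ r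
        ≤ ‖x (n + 2) - x (n + 1)‖ * (2 * ((n + 1 : ℕ) : ℝ) ^ r) :=
      mul_le_mul_of_nonneg_left h4 (norm_nonneg _)
    have h7 : ‖x (n + 1) - x n‖ * ((n + 1 + 1 : ℕ) : ℝ) ^ r
        ≤ ‖x (n + 1) - x n‖ * (2 * (2 * (n : ℝ) ^ r)) :=
      mul_le_mul_of_nonneg_left (by linarith) (norm_nonneg _)
    change _ ≤ 4 * (((n + 1 : ℕ) : ℝ) ^ r * ‖x (n + 2) - x (n + 1)‖) + _
    linarith

theorem InertialEstimates.summable_gap (h : InertialEstimates f L z s α r x y)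
    (hconv : ConvexOn ℝ Set.univ f) (hdiff : Differentiable ℝ f)
    (hL : 0 < L) (hlip : LipschitzWith L (∇ f)) (hz : IsMinOn f Set.univ z)
    (hs : ∀ k, s k ∈ Set.Ioc (0 : ℝ) (1 / (L : ℝ))) (hs_anti : Antitone s)
    (hα : 0 < α) (hr : r ∈ Set.Ioo (0 : ℝ) 1) :
    Summable fun k : ℕ => (k : ℝ) ^ r * s k * (f (y k) - f z) := by
  have hs0 : ∀ n, 0 < s n := fun n => (hs n).1
  have hF : ∀ x, 0 ≤ f x - f z := fun x => sub_nonneg.2 (hz (Set.mem_univ _))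
  have hL' : (0 : ℝ) < L := hL
  obtain ⟨-, -, i3, i4⟩ := h.summable_components hz hs0 hα hr
  rw [← summable_nat_add_iff 1]
  refine Summable.of_norm_bounded_eventually_nat ((i4.mul_left 4).add (i3.mul_left 2)) ?_
  filter_upwards [h.eventually_norm_sub_le hα hr, eventually_ge_atTop 1] with n h1 h2
  have h3 := natCast_rpow_succ_le_two_mul hr h2
  have h4 := sub_min_le_two_mul_add_sq hconv hdiff hL hlip hz (x (n + 1)) (y (n + 1))
  have h5 := one_le_natCast_rpow hr h2
  have h6 : s (n + 1) * L ≤ 1 := by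
    have := (hs (n + 1)).2
    rwa [le_div_iff₀ hL'] at this
  have h8 := hs0 (n + 1)
  have h9 := hF (x (n + 1))
  have h9' := hF (y (n + 1))
  have h10 : ((n + 1 : ℕ) : ℝ) ^ r * s (n + 1) ≤ 2 * (n : ℝ) ^ r * s n :=
    mul_le_mul h3 (hs_anti n.le_succ) h8.le (by positivity)
  have h11 : ‖y (n + 1) - x (n + 1)‖ ^ 2 ≤ ‖x (n + 1) - x n‖ ^ 2 :=
    pow_le_pow_left₀ (norm_nonneg _) h1 2
  have h12 : (s (n + 1) * L) * (((n + 1 : ℕ) : ℝ) ^ r * ‖y (n + 1) - x (n + 1)‖ ^ 2)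
      ≤ 1 * (2 * (n : ℝ) ^ r * ‖x (n + 1) - x n‖ ^ 2) :=
    mul_le_mul h6 (mul_le_mul h3 h11 (by positivity) (by positivity)) (by positivity) one_pos.le
  have h13 := mul_le_mul_of_nonneg_right h10 h9
  have h14 := mul_le_mul_of_nonneg_left h4
    (show 0 ≤ ((n + 1 : ℕ) : ℝ) ^ r * s (n + 1) by positivity)
  rw [Real.norm_of_nonneg (by positivity)]
  linarith

theorem InertialEstimates.summable_increment (h : InertialEstimates f L z s α r x y)
    (hz : IsMinOn f Set.univ z) (hs : ∀ k, 0 < s k) (hα : 0 < α) (hr : r ∈ Set.Ioo (0 : ℝ) 1) :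
    Summable fun k : ℕ => ((k + 1 : ℕ) : ℝ) ^ r * ‖y (k + 1) - y k‖ ^ 2 := by
  obtain ⟨-, -, i3, -⟩ := h.summable_components hz hs hα hr
  have i3' := (summable_nat_add_iff 1).2 i3
  rw [← summable_nat_add_iff 1]
  -- From (2a + b)² ≤ 8a² + 2b², with weight ratios at most 2 over one index and 4 over two.
  refine Summable.of_norm_bounded_eventually_nat ((i3'.mul_left 16).add (i3.mul_left 8)) ?_
  filter_upwards [h.eventually_norm_increment_le hα hr, eventually_ge_atTop 1] with n h1 h2
  have h3 := natCast_rpow_succ_le_two_mul hr h2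
  have h4 := natCast_rpow_succ_le_two_mul hr (show 1 ≤ n + 1 by omega)
  have h5 : ‖y (n + 1 + 1) - y (n + 1)‖ ^ 2
      ≤ 8 * ‖x (n + 2) - x (n + 1)‖ ^ 2 + 2 * ‖x (n + 1) - x n‖ ^ 2 := by
    have := pow_le_pow_left₀ (norm_nonneg _) h1 2
    have := sq_nonneg (2 * ‖x (n + 2) - x (n + 1)‖ - ‖x (n + 1) - x n‖)
    change ‖y (n + 2) - y (n + 1)‖ ^ 2 ≤ _
    linarith
  have h6 := mul_le_mul_of_nonneg_left h5
    (show 0 ≤ ((n + 1 + 1 : ℕ) : ℝ) ^ r by positivity)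
  have h7 := mul_le_mul_of_nonneg_right h4 (sq_nonneg ‖x (n + 2) - x (n + 1)‖)
  have h8 := mul_le_mul_of_nonneg_right
    (show ((n + 1 + 1 : ℕ) : ℝ) ^ r ≤ 2 * (2 * (n : ℝ) ^ r) by linarith)
    (sq_nonneg ‖x (n + 1) - x n‖)
  rw [Real.norm_of_nonneg (by positivity)]
  change _ ≤ 16 * (((n + 1 : ℕ) : ℝ) ^ r * ‖x (n + 2) - x (n + 1)‖ ^ 2) + _
  linarith

/-- Split ∇f(y) into ∇f(y) - ∇f(x) and ∇f(x): the energy decrease controls both, with weights of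
order n^{2r} once the steps are bounded below. -/
theorem InertialEstimates.summable_gradient (h : InertialEstimates f L z s α r x y)
    (hL : 0 < L) (hz : IsMinOn f Set.univ z) (hα : 0 < α) (hr : r ∈ Set.Ioo (0 : ℝ) 1)
    {σ : ℝ} (hσ : 0 < σ) (hσs : ∀ k, σ ≤ s k) :
    Summable fun k : ℕ => (k : ℝ) ^ (2 * r) * ‖∇ f (y k)‖ ^ 2 := by
  have hL' : (0 : ℝ) < L := hL
  have hs : ∀ k, 0 < s k := fun k => hσ.trans_le (hσs k)
  obtain ⟨i1, i2, -, -⟩ := h.summable_components hz hs hα hr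
  have j1 : Summable fun n : ℕ => ((n : ℝ) ^ r) ^ 2 * ‖∇ f (x (n + 1))‖ ^ 2 := by
    rw [← summable_nat_add_iff 1]
    refine Summable.of_nonneg_of_le (fun n => by positivity) (fun n => ?_)
      (i1.mul_left (4 / σ ^ 2))
    have h1 : σ ^ 2 ≤ s (n + 1) ^ 2 := pow_le_pow_left₀ hσ.le (hσs _) 2
    have h2 : 1 ≤ s (n + 1) ^ 2 / σ ^ 2 := (one_le_div (by positivity)).2 h1
    have e : 4 / σ ^ 2 * ((((n + 1 : ℕ) : ℝ) ^ r) ^ 2 * s (n + 1) ^ 2 / 4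
        * ‖∇ f (x (n + 2))‖ ^ 2)
        = s (n + 1) ^ 2 / σ ^ 2 * ((((n + 1 : ℕ) : ℝ) ^ r) ^ 2 * ‖∇ f (x (n + 2))‖ ^ 2) := by
      field_simp
    rw [e]
    exact le_mul_of_one_le_left (by positivity) h2
  rw [← summable_nat_add_iff 1]
  refine Summable.of_norm_bounded_eventually_nat
    ((j1.mul_left 8).add (i2.mul_left (8 * L / σ))) ?_
  filter_upwards [eventually_ge_atTop 1, (tendsto_add_atTop_iff_nat 1).2
    (tendsto_natCast_rpow_atTop hr) |>.eventually_ge_atTop α] with n h2 hn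
  have h3 := natCast_rpow_succ_le_two_mul hr h2
  have hp2 : ((n + 1 : ℕ) : ℝ) ^ (2 * r) = (((n + 1 : ℕ) : ℝ) ^ r) ^ 2 := by
    rw [mul_comm, Real.rpow_mul (by positivity), Real.rpow_ofNat]
  rw [hp2, Real.norm_of_nonneg (by positivity)]
  have h5 : ‖∇ f (y (n + 1))‖ ^ 2 ≤ 2 * ‖∇ f (y (n + 1)) - ∇ f (x (n + 1))‖ ^ 2
      + 2 * ‖∇ f (x (n + 1))‖ ^ 2 := by
    have := norm_add_le (∇ f (y (n + 1)) - ∇ f (x (n + 1))) (∇ f (x (n + 1)))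
    rw [sub_add_cancel] at this
    have := pow_le_pow_left₀ (norm_nonneg _) this 2
    have := sq_nonneg (‖∇ f (y (n + 1)) - ∇ f (x (n + 1))‖ - ‖∇ f (x (n + 1))‖)
    linarith
  have h7 : (((n + 1 : ℕ) : ℝ) ^ r) ^ 2 ≤ 4 * ((n : ℝ) ^ r) ^ 2 := by
    have := pow_le_pow_left₀ (by positivity) h3 2
    linarith
  have h8 := mul_le_mul_of_nonneg_right h7 (sq_nonneg ‖∇ f (x (n + 1))‖)
  have h9 := mul_le_mul_of_nonneg_left h5 (sq_nonneg (((n + 1 : ℕ) : ℝ) ^ r))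
  have h10 : 2 * (((n + 1 : ℕ) : ℝ) ^ r) ^ 2 ≤ 8 * L / σ * (((n + 1 : ℕ) : ℝ) ^ r
      * (((n + 1 : ℕ) : ℝ) ^ r - α / 2) * s (n + 1) / (2 * L)) := by
    have k1 : 1 ≤ s (n + 1) / σ := (one_le_div hσ).2 (hσs _)
    have e : 8 * L / σ * (((n + 1 : ℕ) : ℝ) ^ r
      * (((n + 1 : ℕ) : ℝ) ^ r - α / 2) * s (n + 1) / (2 * L))
      = s (n + 1) / σ * (4 * ((n + 1 : ℕ) : ℝ) ^ r * (((n + 1 : ℕ) : ℝ) ^ r - α / 2)) := by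
      field_simp
      ring
    rw [e]
    have hp : 0 ≤ ((n + 1 : ℕ) : ℝ) ^ r := by positivity
    have k2 : 2 * (((n + 1 : ℕ) : ℝ) ^ r) ^ 2
        ≤ 4 * ((n + 1 : ℕ) : ℝ) ^ r * (((n + 1 : ℕ) : ℝ) ^ r - α / 2) := by nlinarith
    exact k2.trans (le_mul_of_one_le_left (le_trans (by positivity) k2) k1)
  have h11 := mul_le_mul_of_nonneg_right h10
    (sq_nonneg ‖∇ f (y (n + 1)) - ∇ f (x (n + 1))‖)
  linarith

/-- In the anchored energy the gap and the velocity terms tend to 0, the cross term as well because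
x_n - z is bounded; what remains is l²‖x_n - z‖² with l = α/2. -/
theorem InertialEstimates.exists_tendsto_norm_sub (h : InertialEstimates f L z s α r x y)
    (hz : IsMinOn f Set.univ z) (hs : ∀ k, 0 < s k) (hα : 0 < α) (hr : r ∈ Set.Ioo (0 : ℝ) 1) :
    ∃ l, Tendsto (fun n => ‖x n - z‖) atTop (𝓝 l) := by
  obtain ⟨l, hl⟩ := h.energy
  have hv := h.tendsto_velocity hz hs hα hr
  have hgap := h.tendsto_gap hz hs hα hr
  have hF : ∀ x, 0 ≤ f x - f z := fun x => sub_nonneg.2 (hz (Set.mem_univ _))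
  obtain ⟨M, hM⟩ := hl.bddAbove_range
  have hbd : ∀ n, ‖x n - z‖ ≤ √ (2 * M / (α / 2) ^ 2) := fun n => by
    refine Real.le_sqrt_of_sq_le ((le_div_iff₀ (by positivity)).2 ?_)
    have h1 := hM (Set.mem_range_self n)
    have h2 := hs n
    have h3 := hF (x (n + 1))
    have h4 : 0 ≤ s n * ((n : ℝ) ^ r) ^ 2 * (f (x (n + 1)) - f z) := by positivity
    have h5 : 0 ≤ 1 / 2 * ‖(α / 2) • (x n - z) + ((n : ℝ) ^ r) • (x (n + 1) - x n)‖ ^ 2 := by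
      positivity
    simp only [inertialEnergy] at h1
    linarith
  have hin : Tendsto (fun n : ℕ => inner ℝ ((α / 2) • (x n - z))
      (((n : ℝ) ^ r) • (x (n + 1) - x n))) atTop (𝓝 0) := by
    have hb := hv.const_mul (α / 2 * √ (2 * M / (α / 2) ^ 2))
    rw [mul_zero] at hb
    refine squeeze_zero_norm (fun n => ?_) hb
    refine (norm_inner_le_norm _ _).trans ?_
    rw [norm_smul, norm_smul, Real.norm_of_nonneg (by positivity),
      Real.norm_of_nonneg (by positivity : (0 : ℝ) ≤ (n : ℝ) ^ r)]
    have := hbd n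
    gcongr
  have hsq : Tendsto (fun n => ‖x n - z‖ ^ 2) atTop (𝓝 (l / (α / 2) ^ 2)) := by
    have h1 := (((hl.sub hgap).sub hin).sub ((hv.pow 2).const_mul (1 / 2))).div_const
      ((α / 2) ^ 2)
    rw [show (l - 0 - 0 - 1 / 2 * (0 : ℝ) ^ 2) = l by ring] at h1
    refine h1.congr fun n => ?_
    rw [div_eq_iff (by positivity)]
    unfold inertialEnergy
    rw [norm_add_sq_real, norm_smul, norm_smul, Real.norm_of_nonneg (by positivity),
      Real.norm_of_nonneg (by positivity : (0 : ℝ) ≤ (n : ℝ) ^ r)]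
    ring
  refine ⟨_, hsq.sqrt.congr fun n => ?_⟩
  exact Real.sqrt_sq (norm_nonneg _)

theorem InertialEstimates.tendsto_y_sub (h : InertialEstimates f L z s α r x y)
    (hz : IsMinOn f Set.univ z) (hs : ∀ k, 0 < s k) (hα : 0 < α) (hr : r ∈ Set.Ioo (0 : ℝ) 1) :
    Tendsto (fun n => y n - x n) atTop (𝓝 0) := by
  rw [← tendsto_add_atTop_iff_nat 1]
  refine squeeze_zero_norm' ?_ (h.tendsto_velocity hz hs hα hr)
  filter_upwards [h.eventually_norm_sub_le hα hr, eventually_ge_atTop 1] with n h1 h2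
  exact h1.trans (le_mul_of_one_le_left (norm_nonneg _) (one_le_natCast_rpow hr h2))

theorem InertialEstimates.tendsto_f (h : InertialEstimates f L z s α r x y)
    (hz : IsMinOn f Set.univ z) (hα : 0 < α) (hr : r ∈ Set.Ioo (0 : ℝ) 1)
    {σ : ℝ} (hσ : 0 < σ) (hσs : ∀ k, σ ≤ s k) :
    Tendsto (fun n => f (x n)) atTop (𝓝 (f z)) := by
  have hs : ∀ k, 0 < s k := fun k => hσ.trans_le (hσs k)
  have hF : ∀ x, 0 ≤ f x - f z := fun x => sub_nonneg.2 (hz (Set.mem_univ _))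
  rw [← tendsto_add_atTop_iff_nat 1, ← tendsto_sub_nhds_zero_iff]
  have hg := (h.tendsto_gap hz hs hα hr).const_mul σ⁻¹
  rw [mul_zero] at hg
  refine squeeze_zero' (Eventually.of_forall fun n => hF _) ?_ hg
  filter_upwards [eventually_ge_atTop 1] with n hn
  have h1 := one_le_natCast_rpow hr hn
  have h2 : 1 ≤ σ⁻¹ * (s n * ((n : ℝ) ^ r) ^ 2) := by
    have k1 : 1 ≤ s n / σ := (one_le_div hσ).2 (hσs n)
    have k2 : 1 ≤ ((n : ℝ) ^ r) ^ 2 := one_le_pow₀ h1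
    have := one_le_mul_of_one_le_of_one_le k1 k2
    rw [div_eq_inv_mul] at this
    linarith
  rw [← mul_assoc]
  exact le_mul_of_one_le_left (hF _) h2

end Rates

/-! ### Opial's lemma and measurability of the weak limit. -/

section WeakConvergence

variable {H : Type*} [NormedAddCommGroup H] [InnerProductSpace ℝ H]

/-- In a Hilbert space a bounded family has a weak limit along every ultrafilter. -/
theorem exists_tendsto_inner_of_ultrafilter [CompleteSpace H] {ι : Type*} {x : ι → H} {M : ℝ}
    (hM : ∀ n, ‖x n‖ ≤ M) (U : Ultrafilter ι) :
    ∃ Y : H, ∀ h, Tendsto (fun n => (inner ℝ (x n) h : ℝ)) U (𝓝 (inner ℝ Y h)) := by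
  let φ : ι → WeakDual ℝ H := fun n =>
    StrongDual.toWeakDual (InnerProductSpace.toDual ℝ H (x n))
  have hK := WeakDual.isCompact_closedBall (𝕜 := ℝ) (E := H) (0 : StrongDual ℝ H) M
  have hmem : ∀ n, φ n ∈ WeakDual.toStrongDual ⁻¹' Metric.closedBall (0 : StrongDual ℝ H) M := by
    intro n
    rw [Set.mem_preimage, mem_closedBall_zero_iff]
    change ‖InnerProductSpace.toDual ℝ H (x n)‖ ≤ M
    rw [LinearIsometryEquiv.norm_map]
    exact hM n
  obtain ⟨ψ, -, hψ⟩ := hK.ultrafilter_le_nhds (U.map φ)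
    (le_principal_iff.2 (Ultrafilter.mem_map.2 (Filter.univ_mem' hmem)))
  refine ⟨(InnerProductSpace.toDual ℝ H).symm (WeakDual.toStrongDual ψ), fun h => ?_⟩
  have h1 : Tendsto (fun n => φ n h) U (𝓝 (ψ h)) :=
    ((WeakDual.eval_continuous h).tendsto ψ).comp hψ
  rw [InnerProductSpace.toDual_symm_apply]
  exact h1

/-- Opial's lemma for minimizing sequences of a differentiable convex function. -/
theorem exists_weak_limit_isMinOn [CompleteSpace H] {f : H → ℝ} (hconv : ConvexOn ℝ Set.univ f)
    (hdiff : Differentiable ℝ f) {z : H} (hz : IsMinOn f Set.univ z) {x : ℕ → H}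
    (hf : Tendsto (fun n => f (x n)) atTop (𝓝 (f z)))
    (hx : ∀ z, IsMinOn f Set.univ z → ∃ l, Tendsto (fun n => ‖x n - z‖) atTop (𝓝 l)) :
    ∃ Y : H, IsMinOn f Set.univ Y ∧
      ∀ h, Tendsto (fun n => (inner ℝ (x n) h : ℝ)) atTop (𝓝 (inner ℝ Y h)) := by
  obtain ⟨l, hl⟩ := hx z hz
  obtain ⟨M, hM⟩ := hl.bddAbove_range
  have hbd : ∀ n, ‖x n‖ ≤ M + ‖z‖ := fun n => by
    have h1 : ‖x n - z‖ ≤ M := hM (Set.mem_range_self n)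
    have h2 := norm_add_le (x n - z) z
    rw [sub_add_cancel] at h2
    linarith
  -- Ultrafilters replace weakly convergent subsequences; the tangent inequality at Y plays the role
  -- of weak lower semicontinuity.
  have hmin : ∀ U : Ultrafilter ℕ, (U : Filter ℕ) ≤ atTop → ∃ Y, IsMinOn f Set.univ Y ∧
      ∀ h, Tendsto (fun n => (inner ℝ (x n) h : ℝ)) U (𝓝 (inner ℝ Y h)) := by
    intro U hU
    obtain ⟨Y, hY⟩ := exists_tendsto_inner_of_ultrafilter hbd U
    refine ⟨Y, fun v _ => ?_, hY⟩
    have h1 : Tendsto (fun n => f Y + (inner ℝ (x n) (∇ f Y) - inner ℝ Y (∇ f Y))) U (𝓝 (f Y)) := by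
      simpa using ((hY (∇ f Y)).sub_const (inner ℝ Y (∇ f Y))).const_add (f Y)
    have h2 : f Y ≤ f z := by
      refine le_of_tendsto_of_tendsto' h1 (hf.mono_left hU) fun n => ?_
      have := hconv.add_inner_gradient_le hdiff Y (x n)
      rwa [inner_sub_right, real_inner_comm, real_inner_comm Y] at this
    exact h2.trans (hz (Set.mem_univ v))
  obtain ⟨Y, hYm, hY⟩ := hmin (hyperfilter ℕ) (Nat.cofinite_eq_atTop ▸ hyperfilter_le_cofinite)
  refine ⟨Y, hYm, fun h => (tendsto_iff_ultrafilter _ _ _).2 fun U hU => ?_⟩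
  obtain ⟨Z, hZm, hZ⟩ := hmin U hU
  suffices hYZ : Y = Z by rw [hYZ]; exact hZ h
  obtain ⟨lY, hlY⟩ := hx Y hYm
  obtain ⟨lZ, hlZ⟩ := hx Z hZm
  -- By polarisation the convergence of ‖x_n - Y‖ and ‖x_n - Z‖ forces that of ⟨x_n, Y - Z⟩, so Y
  -- and Z have the same inner product with Y - Z.
  have hconvg : Tendsto (fun n => (inner ℝ (x n) (Y - Z) : ℝ)) atTop
      (𝓝 ((lZ ^ 2 - lY ^ 2 + ‖Y‖ ^ 2 - ‖Z‖ ^ 2) / 2)) := by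
    refine (((((hlZ.pow 2).sub (hlY.pow 2)).add_const (‖Y‖ ^ 2)).sub_const
      (‖Z‖ ^ 2)).div_const 2).congr fun n => ?_
    rw [norm_sub_sq_real, norm_sub_sq_real, inner_sub_right]
    ring
  have e1 := tendsto_nhds_unique (hY (Y - Z))
    (hconvg.mono_left (Nat.cofinite_eq_atTop ▸ hyperfilter_le_cofinite))
  have e2 := tendsto_nhds_unique (hZ (Y - Z)) (hconvg.mono_left hU)
  have e3 : inner ℝ (Y - Z) (Y - Z) = (0 : ℝ) := by rw [inner_sub_left, e1, e2, sub_self]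
  exact sub_eq_zero.1 (inner_self_eq_zero.1 e3)

/-- The distance to z changes by at most dist z u when z is replaced by u, uniformly in n. It lets a
countable dense set of minimisers stand for all of them. -/
theorem exists_tendsto_norm_sub_of_mem_closure {E : Type*} [SeminormedAddCommGroup E]
    {x : ℕ → E} {D : Set E}
    (hD : ∀ z ∈ D, ∃ l, Tendsto (fun n => ‖x n - z‖) atTop (𝓝 l)) {z : E} (hz : z ∈ closure D) :
    ∃ l, Tendsto (fun n => ‖x n - z‖) atTop (𝓝 l) := by
  refine cauchySeq_tendsto_of_complete (Metric.cauchySeq_iff.2 fun ε hε => ?_)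
  obtain ⟨u, huD, hu⟩ := Metric.mem_closure_iff.1 hz (ε / 4) (by linarith)
  obtain ⟨l, hl⟩ := hD u huD
  obtain ⟨N, hN⟩ := Metric.cauchySeq_iff.1 hl.cauchySeq (ε / 4) (by linarith)
  refine ⟨N, fun m hm n hn => ?_⟩
  have h1 := hN m hm n hn
  have h2 : ∀ k, |‖x k - z‖ - ‖x k - u‖| ≤ dist z u := fun k => by
    refine (abs_norm_sub_norm_le _ _).trans (le_of_eq ?_)
    rw [sub_sub_sub_cancel_left, ← dist_eq_norm, dist_comm]
  have h3 := h2 m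
  have h4 := h2 n
  rw [Real.dist_eq] at h1 ⊢
  rw [abs_lt] at h1 ⊢
  rw [abs_le] at h3 h4
  constructor <;> linarith

theorem norm_le_iff_forall_inner_denseSeq [SecondCountableTopology H] (u : H) {q : ℝ} (hq : 0 ≤ q) :
    ‖u‖ ≤ q ↔ ∀ n, inner ℝ u (TopologicalSpace.denseSeq H n)
      ≤ q * ‖TopologicalSpace.denseSeq H n‖ := by
  refine ⟨fun h n => (real_inner_le_norm _ _).trans (by gcongr), fun h => ?_⟩
  have h1 : ∀ v : H, inner ℝ u v ≤ q * ‖v‖ := by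
    intro v
    have hc : IsClosed {v : H | inner ℝ u v ≤ q * ‖v‖} :=
      isClosed_le (by fun_prop) (by fun_prop)
    refine (TopologicalSpace.denseRange_denseSeq H).induction_on v hc h
  have h2 := h1 u
  rw [real_inner_self_eq_norm_sq] at h2
  rcases (norm_nonneg u).eq_or_lt with h0 | h0
  · rw [← h0]; exact hq
  · nlinarith

/-- Weakly measurable functions with values in a separable inner product space are measurable. -/
theorem measurable_of_forall_measurable_inner [SecondCountableTopology H] [MeasurableSpace H]
    [BorelSpace H] {Ω : Type*} [MeasurableSpace Ω] {Y : Ω → H}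
    (hY : ∀ h, Measurable fun ω => (inner ℝ (Y ω) h : ℝ)) : Measurable Y := by
  have hball : ∀ (c : H) (q : ℝ), 0 ≤ q → MeasurableSet (Y ⁻¹' Metric.closedBall c q) := by
    intro c q hq
    have : Y ⁻¹' Metric.closedBall c q = ⋂ n, {ω | inner ℝ (Y ω) (TopologicalSpace.denseSeq H n)
        - inner ℝ c (TopologicalSpace.denseSeq H n) ≤ q * ‖TopologicalSpace.denseSeq H n‖} := by
      ext ω
      rw [Set.mem_preimage, mem_closedBall_iff_norm, norm_le_iff_forall_inner_denseSeq _ hq,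
        Set.mem_iInter]
      refine forall_congr' fun n => ?_
      rw [inner_sub_left]
      rfl
    rw [this]
    exact MeasurableSet.iInter fun n =>
      measurableSet_le ((hY _).sub_const _) measurable_const
  refine measurable_of_isOpen fun O hO => ?_
  have hcov : O = ⋃ p : {p : ℕ × ℕ // Metric.closedBall (TopologicalSpace.denseSeq H p.1)
      (1 / ((p.2 : ℝ) + 1)) ⊆ O},
      Metric.closedBall (TopologicalSpace.denseSeq H p.1.1) (1 / ((p.1.2 : ℝ) + 1)) := by
    refine Set.Subset.antisymm (fun v hv => ?_) (Set.iUnion_subset fun p => p.2)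
    obtain ⟨ε, hε, hεO⟩ := Metric.isOpen_iff.1 hO v hv
    obtain ⟨k, hk⟩ := exists_nat_one_div_lt (half_pos hε)
    have hk0 : 0 < 1 / ((k : ℝ) + 1) := by positivity
    obtain ⟨n, hn⟩ := (TopologicalSpace.denseRange_denseSeq H).exists_dist_lt v hk0
    refine Set.mem_iUnion.2 ⟨⟨(n, k), fun u hu => hεO ?_⟩, hn.le⟩
    rw [Metric.mem_ball]
    have h1 : dist u (TopologicalSpace.denseSeq H n) ≤ 1 / ((k : ℝ) + 1) := hu
    have h2 := dist_triangle u (TopologicalSpace.denseSeq H n) v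
    rw [dist_comm (TopologicalSpace.denseSeq H n) v] at h2
    linarith
  rw [hcov, Set.preimage_iUnion]
  exact MeasurableSet.iUnion fun p => hball _ _ (by positivity)

theorem tendsto_toWeakSpace_of_forall_inner [CompleteSpace H] {ι : Type*} {l : Filter ι} {x : ι → H}
    {Y : H} (h : ∀ v, Tendsto (fun n => (inner ℝ (x n) v : ℝ)) l (𝓝 (inner ℝ Y v))) :
    Tendsto (fun n => toWeakSpace ℝ H (x n)) l (𝓝 (toWeakSpace ℝ H Y)) := by
  have hinj : Function.Injective (topDualPairing ℝ H).flip := fun u v huv => by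
    refine ext_inner_left ℝ fun w => ?_
    exact congrArg (fun φ => φ (InnerProductSpace.toDual ℝ H w)) huv
  refine (WeakBilin.tendsto_iff_forall_eval_tendsto _ hinj).2 fun φ => ?_
  obtain ⟨v, rfl⟩ := (InnerProductSpace.toDual ℝ H).surjective φ
  have := h v
  simp_rw [real_inner_comm v] at this
  exact this

/-- A pointwise a.e. weak limit of measurable functions has a measurable version, which can be
chosen to satisfy a given nonempty pointwise constraint everywhere. -/
theorem exists_measurable_weak_limit [SecondCountableTopology H] [MeasurableSpace H]
    [BorelSpace H] {Ω : Type*} [MeasurableSpace Ω] {P : Measure Ω} {x : ℕ → Ω → H}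
    (hx : ∀ n, Measurable (x n)) {S : Set H} (hS : S.Nonempty)
    (h : ∀ᵐ ω ∂P, ∃ Y ∈ S, ∀ v, Tendsto (fun n => (inner ℝ (x n ω) v : ℝ)) atTop
      (𝓝 (inner ℝ Y v))) :
    ∃ Y : Ω → H, Measurable Y ∧ (∀ ω, Y ω ∈ S) ∧
      ∀ᵐ ω ∂P, ∀ v, Tendsto (fun n => (inner ℝ (x n ω) v : ℝ)) atTop (𝓝 (inner ℝ (Y ω) v)) := by
  classical
  obtain ⟨z, hz⟩ := hS
  -- The exceptional set need not be measurable; on a measurable null superset the limit is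
  -- redefined as the constant z.
  obtain ⟨G, hGsub, hGm, hG0⟩ := exists_measurable_superset_of_null (ae_iff.1 h)
  have hgood : ∀ ω, ω ∉ G → ∃ Y ∈ S, ∀ v, Tendsto (fun n => (inner ℝ (x n ω) v : ℝ)) atTop
      (𝓝 (inner ℝ Y v)) := fun ω hω => by
    by_contra hc
    exact hω (hGsub hc)
  choose! Z hZS hZ using hgood
  have hae : ∀ᵐ ω ∂P, ω ∉ G := measure_eq_zero_iff_ae_notMem.1 hG0
  refine ⟨fun ω => if ω ∈ G then z else Z ω, ?_, fun ω => ?_, ?_⟩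
  · refine measurable_of_forall_measurable_inner fun v => ?_
    refine measurable_of_tendsto_metrizable
      (f := fun n ω => if ω ∈ G then (inner ℝ z v : ℝ) else inner ℝ (x n ω) v)
      (fun n => Measurable.ite hGm measurable_const ((hx n).inner measurable_const)) ?_
    refine tendsto_pi_nhds.2 fun ω => ?_
    by_cases hω : ω ∈ G
    · simp only [hω, if_true]; exact tendsto_const_nhds
    · simp only [hω, if_false]; exact hZ ω hω v
  · by_cases hω : ω ∈ G
    · simpa only [hω, if_true] using hz
    · simpa only [hω, if_false] using hZS ω hω
  · filter_upwards [hae] with ω hω v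
    simp only [hω, if_false]
    exact hZ ω hω v

end WeakConvergence

/-! ### The main theorem. -/

theorem corollary5p2
    {H : Type*} [NormedAddCommGroup H] [InnerProductSpace ℝ H] [CompleteSpace H]
    [TopologicalSpace.SeparableSpace H] [MeasurableSpace H] [BorelSpace H]
    {Ω : Type*} [MeasurableSpace Ω] (P : Measure Ω) [IsProbabilityMeasure P]
    -- the objective function
    (f : H → ℝ) (hconv : ConvexOn ℝ Set.univ f) (hdiff : Differentiable ℝ f)
    (L : ℝ≥0) (hL : 0 < L) (hlip : LipschitzWith L (∇ f))
    (hmin : ∃ x, IsMinOn f Set.univ x)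
    -- step sizes and extrapolation coefficients
    (s : ℕ → ℝ) (hs : ∀ k, s k ∈ Set.Ioc (0 : ℝ) (1 / (L : ℝ))) (hs_anti : Antitone s)
    (α r : ℝ) (hα : 0 < α) (hr : r ∈ Set.Ioo (0 : ℝ) 1)
    -- the algorithm
    (e y w : ℕ → Ω → H) (he : ∀ k, Measurable (e k))
    (hy0 : Measurable (y 0)) (hy0_sq : MemLp (y 0) 2 P)
    (hsrag : IsSRAG f s (fun k => 1 - α / (k : ℝ) ^ r) e y w)
    -- the errors: conditionally centred, with finite conditional variance, summable as required
    (he_int : ∀ k, Integrable (e k) P)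
    (he_zero : ∀ k, P[e k | sragSigma y w k] =ᵐ[P] 0)
    (hσ_fin : ∀ k, ∀ᵐ ω ∂P, noiseVar P (sragSigma y w) e k ω < ∞)
    (hσ_sum : MemEllPlus P (sragSigma y w) 1
      (fun k ω => (k : ℝ) ^ r * s k * noiseStd P (sragSigma y w) e k ω)) :
    (∀ᵐ ω ∂P,
      ((fun k => f (y k ω) - ⨅ x, f x) =o[atTop] fun k : ℕ => 1 / (s k * (k : ℝ) ^ (2 * r))) ∧
      ((fun k => ‖y (k + 1) ω - y k ω‖) =o[atTop] fun k : ℕ => 1 / ((k + 1 : ℕ) : ℝ) ^ r) ∧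
      (Summable fun k : ℕ => (k : ℝ) ^ r * s k * (f (y k ω) - ⨅ x, f x)) ∧
      (Summable fun k : ℕ => ((k + 1 : ℕ) : ℝ) ^ r * ‖y (k + 1) ω - y k ω‖ ^ 2)) ∧
    (0 < ⨅ k, s k →
      (∀ᵐ ω ∂P, Summable fun k : ℕ => (k : ℝ) ^ (2 * r) * ‖∇ f (y k ω)‖ ^ 2) ∧
      ∃ Y : Ω → H, Measurable Y ∧ (∀ ω, IsMinOn f Set.univ (Y ω)) ∧
        ∀ᵐ ω ∂P, Tendsto (fun k => toWeakSpace ℝ H (y k ω)) atTop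
          (𝓝 (toWeakSpace ℝ H (Y ω)))) := by
  have : SecondCountableTopology H := UniformSpace.secondCountable_of_separable H
  have hg : Continuous (∇ f) := hlip.continuous
  have hs0 : ∀ k, 0 < s k := fun k => (hs k).1
  have hsum : ∀ᵐ ω ∂P, Summable fun k : ℕ =>
      (k : ℝ) ^ r * s k * noiseStd P (sragSigma y w) e k ω := by
    filter_upwards [hσ_sum.summable] with ω hω
    simpa only [Real.rpow_one] using hω
  obtain ⟨z, hz⟩ := hmin
  have hinf : ⨅ x, f x = f z :=
    le_antisymm (ciInf_le ⟨f z, by rintro _ ⟨u, rfl⟩; exact hz (Set.mem_univ u)⟩ z)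
      (le_ciInf fun u => hz (Set.mem_univ u))
  have hest : ∀ u, IsMinOn f Set.univ u → ∀ᵐ ω ∂P, InertialEstimates f L u s α r
      (fun n => sragIter y w n ω) (fun n => y n ω) := by
    intro u hu
    filter_upwards [hsrag.ae_energy_asymptotics hconv hdiff hL hlip hu hs hs_anti hα hr he hy0
      he_int he_zero hσ_fin hsum] with ω hω
    exact ⟨fun n => hsrag.y_succ n ω, hω.1, hω.2.1, hω.2.2⟩
  rw [hinf]
  refine ⟨?_, fun hpos => ⟨?_, ?_⟩⟩
  · filter_upwards [hest z hz] with ω hω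
    exact ⟨hω.isLittleO_gap hconv hdiff hL hlip hz hs hs_anti hα hr,
      hω.isLittleO_increment hz hs0 hα hr,
      hω.summable_gap hconv hdiff hL hlip hz hs hs_anti hα hr,
      hω.summable_increment hz hs0 hα hr⟩
  · have hσs : ∀ k, ⨅ k, s k ≤ s k :=
      fun k => ciInf_le ⟨0, by rintro _ ⟨j, rfl⟩; exact (hs0 j).le⟩ k
    filter_upwards [hest z hz] with ω hω
    exact hω.summable_gradient hL hz hα hr hpos hσs
  · have hσs : ∀ k, ⨅ k, s k ≤ s k :=
      fun k => ciInf_le ⟨0, by rintro _ ⟨j, rfl⟩; exact (hs0 j).le⟩ k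
    -- The estimates hold off a null set depending on the minimiser; a countable dense set of
    -- minimisers gives a single null set.
    obtain ⟨D, hDS, hDc, hDd⟩ :=
      (TopologicalSpace.IsSeparable.of_separableSpace
        {u | IsMinOn f Set.univ u}).exists_countable_dense_subset
    have hall : ∀ᵐ ω ∂P, ∀ u ∈ D, InertialEstimates f L u s α r
        (fun n => sragIter y w n ω) (fun n => y n ω) :=
      (ae_ball_iff hDc).2 fun u hu => hest u (hDS hu)
    obtain ⟨Y, hYm, hYS, hY⟩ := exists_measurable_weak_limit (P := P) (x := y)
      (S := {u | IsMinOn f Set.univ u}) (fun n => (hsrag.measurable_iter hg he hy0 n).2)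
      ⟨z, hz⟩ (by
        filter_upwards [hest z hz, hall] with ω hω hωD
        obtain ⟨Z, hZm, hZ⟩ := exists_weak_limit_isMinOn hconv hdiff hz
          (hω.tendsto_f hz hα hr hpos hσs) (fun u hu =>
            exists_tendsto_norm_sub_of_mem_closure
              (fun v hv => (hωD v hv).exists_tendsto_norm_sub (hDS hv) hs0 hα hr) (hDd hu))
        refine ⟨Z, hZm, fun v => ?_⟩
        have h1 := ((hω.tendsto_y_sub hz hs0 hα hr).inner (tendsto_const_nhds (x := v))).add (hZ v)
        rw [inner_zero_left, zero_add] at h1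
        refine h1.congr fun n => ?_
        rw [← inner_add_left, sub_add_cancel])
    exact ⟨Y, hYm, hYS, hY.mono fun ω hω => tendsto_toWeakSpace_of_forall_inner hω⟩
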